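/- Let $\mathbb S^1=\mathbb R/\mathbb Z$ with Lebesgue measure $m$ and rotations $R_\beta(x)=x+\beta$. For a smooth function $F$ put $\|F\|_k=\max_{0\le i\le k}\max_x|D^iF(x)|$, and for circle diffeomorphisms $f,g$ (computed on lifts to $\mathbb R$, over $x\in[0,1]$) put $|||f|||_k=\max\{\|f\|_k,\|f^{-1}\|_k\}$ and $d_k(f,g)=\max\{\|f-g\|_k,\|f^{-1}-g^{-1}\|_k\}$. A homeomorphism $H$ of $\mathbb S^1$ is called *singular* if it maps some Lebesgue null set to a conull set. Fix a $C^\infty$ function $\psi:\mathbb R\to[0,1]$ with $\psi=0$ on $(-\infty,0]$, $\psi=1$ on $[1,\infty)$, strictly increasing on $[0,1]$. For $0<t\le 1/10$ let $\ell_1(x)=t(x-\tfrac14)+3t$, $\ell_2(x)=t^{-1}(x-\tfrac12)+\tfrac12$, $\ell_3(x)=t(x-\tfrac34)+1-3t$, write $B_s(u,v)=(1-\psi(s))u+\psi(s)v$, and let $\hat h_t:[0,1]\to[0,1]$ be the increasing $C^\infty$ diffeomorphism $$\hat h_t(x)=\begin{cases} x & x\in[0,t]\\ B_{t^{-1}(x-t)}(x,\ell_1(x))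 & x\in[t,2t]\\ \ell_1(x) & x\in[2t,\tfrac{1-t+8t^2}{2}]\\ B_{t^{-2}(x-\frac{1-t+8t^2}{2})}(\ell_1(x),\ell_2(x)) & x\in[\tfrac{1-t+8t^2}{2},\tfrac{1-t+10t^2}{2}]\\ \ell_2(x) & x\in[\tfrac{1-t+10t^2}{2},\tfrac{1+t-10t^2}{2}]\\ B_{t^{-2}(x-\frac{1+t-10t^2}{2})}(\ell_2(x),\ell_3(x)) & x\in[\tfrac{1+t-10t^2}{2},\tfrac{1+t-8t^2}{2}]\\ \ell_3(x) & x\in[\tfrac{1+t-8t^2}{2},1-2t]\\ B_{t^{-1}(x-1+2t)}(\ell_3(x),x) & x\in[1-2t,1-t]\\ x & x\in[1-t,1]. \end{cases}$$ Let $\alpha$ be a Liouville number, and let $\alpha_n=p_n/q_n$ ($n\ge1$) be rational numbers with $p_n\in\mathbb Z$, $q_n\in\mathbb N$. Put $t_n=q_n^{1-2n}$. Let $h_{q_n}$ be the lift of the circle map $\hat h_{t_n}$ under the $q_n$-fold covering $x\mapsto q_nx$ that has a fixed point, i.e. $h_{q_n}(x)=q_n^{-1}\big(\lfloor q_nx\rfloor+\hat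 h_{t_n}(q_nx-\lfloor q_nx\rfloor)\big)$. For $\mathbf a=(a_n)_{n\ge1}\in\{0,1\}^{\mathbb N}$ put $h_{\mathbf a,n}=h_{q_n}$ if $a_n=0$ and $h_{\mathbf a,n}=h_{q_n}^{-1}$ if $a_n=1$, and $$H_{\mathbf a,0}=\mathrm{id},\qquad H_{\mathbf a,n}=H_{\mathbf a,n-1}\circ h_{\mathbf a,n},\qquad T_{\mathbf a,n}=H_{\mathbf a,n}\circ R_{\alpha_{n+1}}\circ H_{\mathbf a,n}^{-1}.$$ Assume that the numbers $\alpha_n$ are chosen so that $q_1\ge10$ and, for all $n\ge1$, $q_{n+1}\ge q_n^{2n}$, $|\alpha-\alpha_{n+1}|<|\alpha-\alpha_n|$, and $$|\alpha-\alpha_n|<\frac{1}{2n^2\,|||H_{\mathbf b,n}|||_{n+1}^{\,n+1}}\quad\text{for every }\mathbf b\in\{0,1\}^{\mathbb N}.$$ Then for every $\mathbf a\in\{0,1\}^{\mathbb N}$ the diffeomorphisms $T_{\mathbf a,n}$ converge in $d_k$, for every $k$, to an orientation-preserving $C^\infty$ diffeomorphism $T_{\mathbf a}$ of $\mathbb S^1$;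 the maps $H_{\mathbf a,n}$ converge in $d_0$ to an orientation-preserving homeomorphism $H_{\mathbf a}$ of $\mathbb S^1$ with $H_{\mathbf a}(0)=0$ and $H_{\mathbf a}\circ R_\alpha=T_{\mathbf a}\circ H_{\mathbf a}$; and $H_{\mathbf a}$ is singular. In particular there is a Borel set $C\subseteq\mathbb S^1$ with $m(C)>0$ and $m(H_{\mathbf a}(C))=0$. -/

import Mathlib

open Set Filter Topology MeasureTheory
open scoped ContDiff

noncomputable section

namespace AbC

/-- `F : ℝ → ℝ` is a lift of the circle map `f : ℝ/ℤ → ℝ/ℤ`: an increasing continuous function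
with `π ∘ F = f ∘ π`. A circle homeomorphism with such a lift is orientation-preserving. -/
def IsLift (F : ℝ → ℝ) (f : UnitAddCircle → UnitAddCircle) : Prop :=
  StrictMono F ∧ Continuous F ∧ ∀ x : ℝ, ((F x : ℝ) : UnitAddCircle) = f (x : UnitAddCircle)

/-- The `C^k` norm `max_{0 ≤ i ≤ k} max_{x ∈ [0,1]} |D^i F(x)|`. It is applied to lifts of
diffeomorphisms fixing `0` and to differences of two lifts (which are `1`-periodic). -/
def ckNorm (k : ℕ) (F : ℝ → ℝ) : ℝ :=
  sSup {y : ℝ | ∃ i ≤ k, ∃ x ∈ Icc (0 : ℝ) 1, y = |iteratedDeriv i F x|}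

/-- `|||F|||_k = max {‖F‖_k, ‖F⁻¹‖_k}`. -/
def ckSize (k : ℕ) (F : ℝ → ℝ) : ℝ :=
  max (ckNorm k F) (ckNorm k (Function.invFun F))

/-- `d_k(F, G) = max {‖F - G‖_k, ‖F⁻¹ - G⁻¹‖_k}`. -/
def ckDist (k : ℕ) (F G : ℝ → ℝ) : ℝ :=
  max (ckNorm k (fun x => F x - G x))
    (ckNorm k (fun x => Function.invFun F x - Function.invFun G x))

/-- A smooth step function: `0` on `(-∞, 0]`, `1` on `[1, ∞)`, strictly increasing on `[0, 1]`. -/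
structure IsSmoothStep (ψ : ℝ → ℝ) : Prop where
  contDiff : ContDiff ℝ ∞ ψ
  eq_zero : ∀ x ≤ 0, ψ x = 0
  eq_one : ∀ x, 1 ≤ x → ψ x = 1
  strictMonoOn : StrictMonoOn ψ (Icc 0 1)

/-- The interpolation `(1 - ψ(s)) u + ψ(s) v`. -/
def blend (ψ : ℝ → ℝ) (s u v : ℝ) : ℝ := (1 - ψ s) * u + ψ s * v

/-- The first affine piece of slope `t`. -/
def lineLeft (t x : ℝ) : ℝ := t * (x - 1 / 4) + 3 * t

/-- The middle affine piece of slope `t⁻¹`. -/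
def lineMid (t x : ℝ) : ℝ := t⁻¹ * (x - 1 / 2) + 1 / 2

/-- The second affine piece of slope `t`. -/
def lineRight (t x : ℝ) : ℝ := t * (x - 3 / 4) + 1 - 3 * t

/-- The diffeomorphism `ĥ_t` of `[0, 1]`; only its values on `[0, 1]` are used. The break points
are in increasing order exactly when `0 < t ≤ 1 / 10`. -/
def hHat (ψ : ℝ → ℝ) (t x : ℝ) : ℝ :=
  if x ≤ t then x
  else if x ≤ 2 * t then blend ψ (t⁻¹ * (x - t)) x (lineLeft t x)
  else if x ≤ (1 - t + 8 * t ^ 2) / 2 then lineLeft t x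
  else if x ≤ (1 - t + 10 * t ^ 2) / 2 then
    blend ψ ((t ^ 2)⁻¹ * (x - (1 - t + 8 * t ^ 2) / 2)) (lineLeft t x) (lineMid t x)
  else if x ≤ (1 + t - 10 * t ^ 2) / 2 then lineMid t x
  else if x ≤ (1 + t - 8 * t ^ 2) / 2 then
    blend ψ ((t ^ 2)⁻¹ * (x - (1 + t - 10 * t ^ 2) / 2)) (lineMid t x) (lineRight t x)
  else if x ≤ 1 - 2 * t then lineRight t x
  else if x ≤ 1 - t then blend ψ (t⁻¹ * (x - 1 + 2 * t)) (lineRight t x) x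
  else x

/-- `t_n = q_n^{1 - 2n}`. -/
def tSeq (q : ℕ → ℕ) (n : ℕ) : ℝ := (q n : ℝ) ^ (1 - 2 * (n : ℤ))

/-- The lift to `ℝ` of the map `h_{q_n}`: the lift of `ĥ_{t_n}` by the cyclic `q_n`-fold covering
`x ↦ q_n x` of the circle which has a fixed point (it fixes every point of `q_n⁻¹ ℤ`). -/
def hCover (ψ : ℝ → ℝ) (q : ℕ → ℕ) (n : ℕ) (x : ℝ) : ℝ :=
  ((⌊(q n : ℝ) * x⌋ : ℝ) + hHat ψ (tSeq q n) (Int.fract ((q n : ℝ) * x))) / (q n : ℝ)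

/-- `h_{a,n}`, equal to `h_{q_n}` if `a_n = 0` (`false`) and to its inverse if `a_n = 1`
(`true`). -/
def hConj (ψ : ℝ → ℝ) (q : ℕ → ℕ) (a : ℕ → Bool) (n : ℕ) : ℝ → ℝ :=
  if a n = false then hCover ψ q n else Function.invFun (hCover ψ q n)

/-- `H_{a,0} = id` and `H_{a,n} = H_{a,n-1} ∘ h_{a,n}` for `n ≥ 1`. -/
def HConj (ψ : ℝ → ℝ) (q : ℕ → ℕ) (a : ℕ → Bool) : ℕ → ℝ → ℝ
  | 0 => id
  | n + 1 => HConj ψ q a n ∘ hConj ψ q a (n + 1)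

/-- `α_n = p_n / q_n`. -/
def alphaSeq (p : ℕ → ℤ) (q : ℕ → ℕ) (n : ℕ) : ℝ := (p n : ℝ) / (q n : ℝ)

/-- `T_{a,n} = H_{a,n} ∘ R_{α_{n+1}} ∘ H_{a,n}⁻¹`, where `R_β(x) = x + β`. -/
def TApprox (ψ : ℝ → ℝ) (p : ℕ → ℤ) (q : ℕ → ℕ) (a : ℕ → Bool) (n : ℕ) (x : ℝ) : ℝ :=
  HConj ψ q a n (Function.invFun (HConj ψ q a n) x + alphaSeq p q (n + 1))

/-- The way in which the rational numbers `α_n = p_n / q_n`, `n ≥ 1`, are chosen in the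
construction, uniformly in the `0`-`1`-sequence. (The entries with index `0` play no role.) -/
structure IsChoice (ψ : ℝ → ℝ) (α : ℝ) (p : ℕ → ℤ) (q : ℕ → ℕ) : Prop where
  /-- `t_1 = 1 / q_1 ≤ 1 / 10`, so that all the maps `ĥ_{t_n}` are well defined. -/
  start : 10 ≤ q 1
  growth : ∀ n, 1 ≤ n → q n ^ (2 * n) ≤ q (n + 1)
  closer : ∀ n, 1 ≤ n → |α - alphaSeq p q (n + 1)| < |α - alphaSeq p q n|
  close : ∀ n, 1 ≤ n → ∀ b : ℕ → Bool,
    |α - alphaSeq p q n| < 1 / (2 * (n : ℝ) ^ 2 * ckSize (n + 1) (HConj ψ q b n) ^ (n + 1))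

/-- A circle homeomorphism is singular if it maps some Lebesgue null set to a conull set. -/
def IsSingular (f : UnitAddCircle ≃ₜ UnitAddCircle) : Prop :=
  ∃ N : Set UnitAddCircle, MeasurableSet N ∧ volume N = 0 ∧ volume (f '' N)ᶜ = 0

end AbC

end

noncomputable section

namespace AbC

/-! ### The building block on the interval -/

namespace IsSmoothStep

variable {ψ : ℝ → ℝ}

/-! This is approximation by conjugation with a quantitative trade-off: the periods must outgrow the
derivatives of the earlier conjugacies.

Smoothness of the limit. Since `h_{n+1}` commutes with the rotation by `α_{n+1}`, `T_n` is also the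
conjugate of that rotation by `H_{n+1}`. Hence `T_{n+1}` and `T_n` are conjugates of two very close
rotations by the same map, and the `C^k` size of their difference is at most `k! |||H_{n+1}|||^{k+1}
|α_{n+2} - α_{n+1}|` (`IsDiffeoLift.abs_iteratedDeriv_conj_sub_le`). The closeness condition makes
this at most `k!/(n+1)^2` once `k ≤ n + 1`. Inverses are handled by negating the angles.

The key summability. Write `S_n = |||H_n|||_{n+1}`. Distinct fractions satisfy `1/(q_n q_{n+1}) ≤
|α_{n+1} - α_n|`, so closeness to `α` forces `q_n q_{n+1}` to exceed `n^2 S_n^{n+1}`. Together with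
the growth of the `q_n` this makes `S_n / q_{n+1}` summable (`IsChoice.size_div_le`). As `h_{n+1}`
moves points by at most `1/q_{n+1}`, this gives uniform convergence of `H_n`; the inverses converge
at the rate `1/q_{n+1}`.

Singularity. Each `h_n` sends everything outside a `5t_n/q_n`-neighbourhood of one coset of `q_n⁻¹ℤ`
into such a neighbourhood of another; inversion only exchanges the two cosets, so the choice of `a`
is harmless. Let `E_n` be the first neighbourhood, of measure `O(t_n)`. Outside `H_n(E_n)` there
remains only a set of measure `O(S_{n-1} t_n)`, because `H_{n-1}` is `S_{n-1}`-Lipschitz. Passing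
from `H_n` to the limit moves the preimages by `O(t_n/q_n)`, by the growth condition. Two
applications of Borel–Cantelli show that the limsup of the slightly perturbed `E_n` is null and has
conull image (`IsChoice.exists_singular_set`). -/

theorem monotone (hψ : IsSmoothStep ψ) : Monotone ψ := by
  have h0 : ∀ y, 0 ≤ y → ψ 0 ≤ ψ y := fun y hy => by
    rcases le_total y 1 with h | h
    · exact hψ.strictMonoOn.monotoneOn ⟨le_rfl, zero_le_one⟩ ⟨hy, h⟩ hy
    · rw [hψ.eq_one y h, hψ.eq_zero 0 le_rfl]; exact zero_le_one
  intro x y hxy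
  rcases le_total x 0 with hx | hx
  · rw [hψ.eq_zero x hx]
    rcases le_total y 0 with hy | hy
    · rw [hψ.eq_zero y hy]
    · simpa [hψ.eq_zero 0 le_rfl] using h0 y hy
  · rcases le_total y 1 with hy | hy
    · exact hψ.strictMonoOn.monotoneOn ⟨hx, hxy.trans hy⟩ ⟨hx.trans hxy, hy⟩ hxy
    · rw [hψ.eq_one y hy]
      rcases le_total x 1 with h | h
      · rw [← hψ.eq_one 1 le_rfl]
        exact hψ.strictMonoOn.monotoneOn ⟨hx, h⟩ ⟨zero_le_one, le_rfl⟩ h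
      · rw [hψ.eq_one x h]

theorem nonneg (hψ : IsSmoothStep ψ) (x : ℝ) : 0 ≤ ψ x := by
  rcases le_total x 0 with h | h
  · rw [hψ.eq_zero x h]
  · rw [← hψ.eq_zero 0 le_rfl]; exact hψ.monotone h

theorem le_one (hψ : IsSmoothStep ψ) (x : ℝ) : ψ x ≤ 1 := by
  rcases le_total x 1 with h | h
  · rw [← hψ.eq_one 1 le_rfl]; exact hψ.monotone h
  · rw [hψ.eq_one x h]

/-- The step function is locally constant off `[0, 1]`, so the sign of `w` matters only on the
transition interval. -/
theorem deriv_mul_nonneg (hψ : IsSmoothStep ψ) {s w : ℝ} (h : 0 ≤ s → s ≤ 1 → 0 ≤ w) :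
    0 ≤ deriv ψ s * w := by
  rcases lt_or_ge s 0 with hs | hs
  · have : ψ =ᶠ[𝓝 s] fun _ => 0 := by
      filter_upwards [Iio_mem_nhds hs] with y hy using hψ.eq_zero y (le_of_lt hy)
    simp [this.deriv_eq]
  rcases lt_or_ge 1 s with hs' | hs'
  · have : ψ =ᶠ[𝓝 s] fun _ => 1 := by
      filter_upwards [Ioi_mem_nhds hs'] with y hy using hψ.eq_one y (le_of_lt hy)
    simp [this.deriv_eq]
  exact mul_nonneg hψ.monotone.deriv_nonneg (h hs hs')

theorem scaled_eq_zero (hψ : IsSmoothStep ψ) {c a x : ℝ} (hc : 0 < c) (h : x ≤ a) :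
    ψ (c * (x - a)) = 0 :=
  hψ.eq_zero _ (mul_nonpos_of_nonneg_of_nonpos hc.le (by linarith))

theorem scaled_eq_one (hψ : IsSmoothStep ψ) {c a x : ℝ} (hc : 0 < c) (h : a + c⁻¹ ≤ x) :
    ψ (c * (x - a)) = 1 := by
  refine hψ.eq_one _ ?_
  rw [← mul_inv_cancel₀ hc.ne']
  exact mul_le_mul_of_nonneg_left (by linarith) hc.le

theorem scaled_le_scaled (hψ : IsSmoothStep ψ) {c c' a a' : ℝ} (x : ℝ) (hc : 0 < c)
    (hc' : 0 < c') (h : a + c⁻¹ ≤ a') : ψ (c' * (x - a')) ≤ ψ (c * (x - a)) := by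
  rcases le_total x a' with hx | hx
  · rw [hψ.scaled_eq_zero hc' hx]; exact hψ.nonneg _
  · rw [hψ.scaled_eq_one hc (h.trans hx)]; exact hψ.le_one _

theorem hasDerivAt_scaled_mul (hψ : IsSmoothStep ψ) (c a m k x : ℝ) :
    HasDerivAt (fun x => ψ (c * (x - a)) * (m * x + k))
      (deriv ψ (c * (x - a)) * (c * (m * x + k)) + ψ (c * (x - a)) * m) x := by
  have h1 : HasDerivAt (fun x => c * (x - a)) c x := by
    simpa using ((hasDerivAt_id x).sub_const a).const_mul c
  have h2 : HasDerivAt ψ (deriv ψ (c * (x - a))) (c * (x - a)) :=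
    ((hψ.contDiff.differentiable (by simp)) _).hasDerivAt
  have h3 : HasDerivAt (fun x => m * x + k) m x := by
    simpa using ((hasDerivAt_id x).const_mul m).add_const k
  have := (h2.comp x h1).mul h3
  refine this.congr_deriv ?_
  simp only [Function.comp_apply]
  ring

theorem deriv_scaled_mul_nonneg (hψ : IsSmoothStep ψ) {c a w x : ℝ} (hc : 0 < c)
    (h : a ≤ x → x ≤ a + c⁻¹ → 0 ≤ w) : 0 ≤ deriv ψ (c * (x - a)) * (c * w) := by
  refine hψ.deriv_mul_nonneg fun h0 h1 => mul_nonneg hc.le (h ?_ ?_)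
  · have := nonneg_of_mul_nonneg_right h0 hc
    linarith
  · have : x - a ≤ c⁻¹ := by
      rw [← mul_le_mul_iff_right₀ hc, mul_inv_cancel₀ hc.ne']; exact h1
    linarith

end IsSmoothStep

/-- A formula for `hHat` without case distinctions, which makes sense on the whole real line. -/
def hHatSmooth (ψ : ℝ → ℝ) (t x : ℝ) : ℝ :=
  x + ψ (t⁻¹ * (x - t)) * ((t - 1) * x + 11 / 4 * t)
    + ψ ((t ^ 2)⁻¹ * (x - (1 - t + 8 * t ^ 2) / 2)) *
        ((t⁻¹ - t) * x + (1 / 2 - t⁻¹ / 2 - 11 / 4 * t))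
    + ψ ((t ^ 2)⁻¹ * (x - (1 + t - 10 * t ^ 2) / 2)) *
        ((t - t⁻¹) * x + (1 / 2 + t⁻¹ / 2 - 15 / 4 * t))
    + ψ (t⁻¹ * (x - (1 - 2 * t))) * ((1 - t) * x + (15 / 4 * t - 1))

section Breakpoints

variable {ψ : ℝ → ℝ} {t : ℝ}

/-- The affine factors are the differences of consecutive pieces `x, ℓ₁, ℓ₂, ℓ₃, x`, so the sum
telescopes once each cutoff is 0 before its transition interval and 1 after it. The bound `t ≤ 1/10`
keeps the four intervals disjoint and in order. -/
theorem hHat_eq_hHatSmooth (hψ : IsSmoothStep ψ) (ht : 0 < t) (ht' : t ≤ 1 / 10) (x : ℝ) :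
    hHat ψ t x = hHatSmooth ψ t x := by
  have hi : 0 < t⁻¹ := inv_pos.2 ht
  have hi2 : 0 < (t ^ 2)⁻¹ := inv_pos.2 (by positivity)
  have ht2 : 0 < t ^ 2 := by positivity
  have ht3 : t ^ 2 ≤ t / 10 := by nlinarith
  have e4 : x - 1 + 2 * t = x - (1 - 2 * t) := by ring
  have z1 : x ≤ t → ψ (t⁻¹ * (x - t)) = 0 := fun h => hψ.scaled_eq_zero hi h
  have o1 : 2 * t ≤ x → ψ (t⁻¹ * (x - t)) = 1 := fun h =>
    hψ.scaled_eq_one hi (by rw [inv_inv]; linarith)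
  have z2 : x ≤ (1 - t + 8 * t ^ 2) / 2 →
      ψ ((t ^ 2)⁻¹ * (x - (1 - t + 8 * t ^ 2) / 2)) = 0 := fun h => hψ.scaled_eq_zero hi2 h
  have o2 : (1 - t + 10 * t ^ 2) / 2 ≤ x →
      ψ ((t ^ 2)⁻¹ * (x - (1 - t + 8 * t ^ 2) / 2)) = 1 := fun h =>
    hψ.scaled_eq_one hi2 (by rw [inv_inv]; linarith)
  have z3 : x ≤ (1 + t - 10 * t ^ 2) / 2 →
      ψ ((t ^ 2)⁻¹ * (x - (1 + t - 10 * t ^ 2) / 2)) = 0 := fun h => hψ.scaled_eq_zero hi2 h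
  have o3 : (1 + t - 8 * t ^ 2) / 2 ≤ x →
      ψ ((t ^ 2)⁻¹ * (x - (1 + t - 10 * t ^ 2) / 2)) = 1 := fun h =>
    hψ.scaled_eq_one hi2 (by rw [inv_inv]; linarith)
  have z4 : x ≤ 1 - 2 * t → ψ (t⁻¹ * (x - (1 - 2 * t))) = 0 := fun h => hψ.scaled_eq_zero hi h
  have o4 : 1 - t ≤ x → ψ (t⁻¹ * (x - (1 - 2 * t))) = 1 := fun h =>
    hψ.scaled_eq_one hi (by rw [inv_inv]; linarith)
  unfold hHat hHatSmooth blend lineLeft lineMid lineRight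
  rw [e4]
  split_ifs with h1 h2 h3 h4 h5 h6 h7 h8
  · rw [z1 h1, z2 (by linarith), z3 (by linarith), z4 (by linarith)]; ring
  · rw [z2 (by linarith), z3 (by linarith), z4 (by linarith)]; ring
  · rw [o1 (by linarith), z2 h3, z3 (by linarith), z4 (by linarith)]; ring
  · rw [o1 (by linarith), z3 (by linarith), z4 (by linarith)]; ring
  · rw [o1 (by linarith), o2 (by linarith), z3 (by linarith), z4 (by linarith)]; ring
  · rw [o1 (by linarith), o2 (by linarith), z4 (by linarith)]; ring
  · rw [o1 (by linarith), o2 (by linarith), o3 (by linarith), z4 (by linarith)]; ring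
  · rw [o1 (by linarith), o2 (by linarith), o3 (by linarith)]; ring
  · rw [o1 (by linarith), o2 (by linarith), o3 (by linarith), o4 (by linarith)]; ring

theorem contDiff_hHatSmooth (hψ : IsSmoothStep ψ) (t : ℝ) : ContDiff ℝ ∞ (hHatSmooth ψ t) := by
  have key : ∀ c a m k : ℝ, ContDiff ℝ ∞ fun x : ℝ => ψ (c * (x - a)) * (m * x + k) :=
    fun c a m k => (hψ.contDiff.comp (by fun_prop)).mul (by fun_prop)
  unfold hHatSmooth
  exact (((contDiff_id.add (key _ _ _ _)).add (key _ _ _ _)).add (key _ _ _ _)).add (key _ _ _ _)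

/-- Two contributions: the terms with `ψ'` are nonnegative because on each transition interval the
next piece lies above the previous one, and the rest is a convex combination of the slopes `1, t,
t⁻¹, t, 1`, hence at least `t`. -/
theorem deriv_hHatSmooth_pos (hψ : IsSmoothStep ψ) (ht : 0 < t) (ht' : t ≤ 1 / 10) (x : ℝ) :
    0 < deriv (hHatSmooth ψ t) x := by
  have hi : 0 < t⁻¹ := inv_pos.2 ht
  have hti : t⁻¹ * t = 1 := inv_mul_cancel₀ ht.ne'
  have hi2 : 0 < (t ^ 2)⁻¹ := inv_pos.2 (by positivity)
  have ht2 : 0 < t ^ 2 := by positivity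
  have ht3 : t ^ 2 ≤ t / 10 := by nlinarith
  have hit : t ≤ t⁻¹ := by
    have : (1 : ℝ) ≤ t⁻¹ := (one_le_inv₀ ht).2 (by linarith)
    linarith
  have H : HasDerivAt (hHatSmooth ψ t) _ x :=
    ((((hasDerivAt_id x).add (hψ.hasDerivAt_scaled_mul t⁻¹ t _ _ x)).add
      (hψ.hasDerivAt_scaled_mul (t ^ 2)⁻¹ ((1 - t + 8 * t ^ 2) / 2) _ _ x)).add
      (hψ.hasDerivAt_scaled_mul (t ^ 2)⁻¹ ((1 + t - 10 * t ^ 2) / 2) _ _ x)).add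
      (hψ.hasDerivAt_scaled_mul t⁻¹ (1 - 2 * t) _ _ x)
  rw [H.deriv]
  have d1 := hψ.deriv_scaled_mul_nonneg (c := t⁻¹) (a := t) (x := x)
    (w := (t - 1) * x + 11 / 4 * t) hi (fun _ h => by rw [inv_inv] at h; nlinarith)
  have d2 := hψ.deriv_scaled_mul_nonneg (c := (t ^ 2)⁻¹) (a := (1 - t + 8 * t ^ 2) / 2) (x := x)
    (w := (t⁻¹ - t) * x + (1 / 2 - t⁻¹ / 2 - 11 / 4 * t)) hi2 (fun h h' => by
      rw [inv_inv] at h'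
      have : t⁻¹ * ((1 - t + 8 * t ^ 2) / 2) ≤ t⁻¹ * x := mul_le_mul_of_nonneg_left h hi.le
      have e : t⁻¹ * ((1 - t + 8 * t ^ 2) / 2) = t⁻¹ / 2 - 1 / 2 + 4 * t := by field_simp; ring
      nlinarith)
  have d3 := hψ.deriv_scaled_mul_nonneg (c := (t ^ 2)⁻¹) (a := (1 + t - 10 * t ^ 2) / 2) (x := x)
    (w := (t - t⁻¹) * x + (1 / 2 + t⁻¹ / 2 - 15 / 4 * t)) hi2 (fun h h' => by
      rw [inv_inv] at h'
      have : t⁻¹ * x ≤ t⁻¹ * ((1 + t - 8 * t ^ 2) / 2) :=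
        mul_le_mul_of_nonneg_left (by linarith) hi.le
      have e : t⁻¹ * ((1 + t - 8 * t ^ 2) / 2) = t⁻¹ / 2 + 1 / 2 - 4 * t := by field_simp; ring
      nlinarith)
  have d4 := hψ.deriv_scaled_mul_nonneg (c := t⁻¹) (a := 1 - 2 * t) (x := x)
    (w := (1 - t) * x + (15 / 4 * t - 1)) hi (fun h _ => by nlinarith)
  have m1 := hψ.le_one (t⁻¹ * (x - t))
  have m2 := hψ.scaled_le_scaled (a := t) (a' := (1 - t + 8 * t ^ 2) / 2) x hi hi2
    (by rw [inv_inv]; linarith)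
  have m3 := hψ.scaled_le_scaled (a := (1 - t + 8 * t ^ 2) / 2) (a' := (1 + t - 10 * t ^ 2) / 2)
    x hi2 hi2 (by rw [inv_inv]; linarith)
  have m4 := hψ.scaled_le_scaled (a := (1 + t - 10 * t ^ 2) / 2) (a' := 1 - 2 * t) x hi2 hi
    (by rw [inv_inv]; linarith)
  have m5 := hψ.nonneg (t⁻¹ * (x - (1 - 2 * t)))
  set A := ψ (t⁻¹ * (x - t))
  set B := ψ ((t ^ 2)⁻¹ * (x - (1 - t + 8 * t ^ 2) / 2))
  set C := ψ ((t ^ 2)⁻¹ * (x - (1 + t - 10 * t ^ 2) / 2))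
  set D := ψ (t⁻¹ * (x - (1 - 2 * t)))
  -- The weights of the five slopes are `1 - A, A - B, B - C, C - D, D`; the right side exceeds `t`
  -- by `(1 - A)(1 - t) + (B - C)(t⁻¹ - t) + D(1 - t)`.
  have main : t ≤ 1 + A * (t - 1) + B * (t⁻¹ - t) + C * (t - t⁻¹) + D * (1 - t) := by
    have := mul_nonneg (sub_nonneg.2 m1) (by linarith : (0 : ℝ) ≤ 1 - t)
    have := mul_nonneg (sub_nonneg.2 m3) (sub_nonneg.2 hit)
    have := mul_nonneg m5 (by linarith : (0 : ℝ) ≤ 1 - t)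
    nlinarith
  linarith

theorem strictMono_hHatSmooth (hψ : IsSmoothStep ψ) (ht : 0 < t) (ht' : t ≤ 1 / 10) :
    StrictMono (hHatSmooth ψ t) :=
  strictMono_of_deriv_pos (deriv_hHatSmooth_pos hψ ht ht')

theorem hHatSmooth_eq_self_of_le (hψ : IsSmoothStep ψ) (ht : 0 < t) (ht' : t ≤ 1 / 10) {x : ℝ}
    (h : x ≤ t) : hHatSmooth ψ t x = x := by
  rw [← hHat_eq_hHatSmooth hψ ht ht', hHat, if_pos h]

theorem hHatSmooth_eq_self_of_ge (hψ : IsSmoothStep ψ) (ht : 0 < t) (ht' : t ≤ 1 / 10) {x : ℝ}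
    (h : 1 - t ≤ x) : hHatSmooth ψ t x = x := by
  have hi : 0 < t⁻¹ := inv_pos.2 ht
  have hi2 : 0 < (t ^ 2)⁻¹ := inv_pos.2 (by positivity)
  have ht2 : 0 < t ^ 2 := by positivity
  have ht3 : t ^ 2 ≤ t / 10 := by nlinarith
  unfold hHatSmooth
  rw [hψ.scaled_eq_one hi (by rw [inv_inv]; linarith),
    hψ.scaled_eq_one hi2 (by rw [inv_inv]; linarith),
    hψ.scaled_eq_one hi2 (by rw [inv_inv]; linarith),
    hψ.scaled_eq_one hi (by rw [inv_inv]; linarith)]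
  ring

/-- With its mirror image below, this is the origin of the constant 5: the steep middle piece, over
an interval of length less than `t`, already covers `[5t, 1 - 5t]`. -/
theorem hHatSmooth_left (hψ : IsSmoothStep ψ) (ht : 0 < t) (ht' : t ≤ 1 / 10) :
    hHatSmooth ψ t ((1 - t + 10 * t ^ 2) / 2) = 5 * t := by
  have hi : 0 < t⁻¹ := inv_pos.2 ht
  have hi2 : 0 < (t ^ 2)⁻¹ := inv_pos.2 (by positivity)
  have ht2 : 0 < t ^ 2 := by positivity
  have ht3 : t ^ 2 ≤ t / 10 := by nlinarith
  unfold hHatSmooth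
  rw [hψ.scaled_eq_one hi (by rw [inv_inv]; linarith),
    hψ.scaled_eq_one hi2 (by rw [inv_inv]; linarith),
    hψ.scaled_eq_zero hi2 (by linarith), hψ.scaled_eq_zero hi (by linarith)]
  field_simp
  ring

theorem hHatSmooth_right (hψ : IsSmoothStep ψ) (ht : 0 < t) (ht' : t ≤ 1 / 10) :
    hHatSmooth ψ t ((1 + t - 10 * t ^ 2) / 2) = 1 - 5 * t := by
  have hi : 0 < t⁻¹ := inv_pos.2 ht
  have hi2 : 0 < (t ^ 2)⁻¹ := inv_pos.2 (by positivity)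
  have ht2 : 0 < t ^ 2 := by positivity
  have ht3 : t ^ 2 ≤ t / 10 := by nlinarith
  unfold hHatSmooth
  rw [hψ.scaled_eq_one hi (by rw [inv_inv]; linarith),
    hψ.scaled_eq_one hi2 (by rw [inv_inv]; linarith),
    hψ.scaled_eq_zero hi2 (by linarith), hψ.scaled_eq_zero hi (by linarith)]
  field_simp
  ring

end Breakpoints


/-! ### Lifts of orientation-preserving circle diffeomorphisms -/

/-- Lifts to `ℝ` of orientation-preserving smooth circle diffeomorphisms. -/
structure IsDiffeoLift (F : ℝ → ℝ) : Prop where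
  contDiff : ContDiff ℝ ∞ F
  deriv_pos : ∀ x, 0 < deriv F x
  map_add_one : ∀ x, F (x + 1) = F x + 1

namespace IsDiffeoLift

variable {F G : ℝ → ℝ}

theorem strictMono (hF : IsDiffeoLift F) : StrictMono F := strictMono_of_deriv_pos hF.deriv_pos

theorem continuous (hF : IsDiffeoLift F) : Continuous F := hF.contDiff.continuous

theorem differentiable (hF : IsDiffeoLift F) : Differentiable ℝ F :=
  hF.contDiff.differentiable (by simp)

theorem surjective (hF : IsDiffeoLift F) : Function.Surjective F := by
  let f : CircleDeg1Lift := ⟨⟨F, hF.strictMono.monotone⟩, hF.map_add_one⟩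
  exact hF.continuous.surjective f.tendsto_atTop f.tendsto_atBot

theorem invFun_apply (hF : IsDiffeoLift F) (x : ℝ) : Function.invFun F (F x) = x :=
  Function.leftInverse_invFun hF.strictMono.injective x

theorem apply_invFun (hF : IsDiffeoLift F) (x : ℝ) : F (Function.invFun F x) = x :=
  Function.rightInverse_invFun hF.surjective x

theorem invFun_eq (hF : IsDiffeoLift F) (h : ∀ x, F (G x) = x) : Function.invFun F = G :=
  funext fun x => hF.strictMono.injective (by rw [hF.apply_invFun, h])

theorem invFun (hF : IsDiffeoLift F) : IsDiffeoLift (Function.invFun F) := by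
  let e := (hF.strictMono.orderIsoOfSurjective F hF.surjective).toHomeomorph
  have he : (e.symm : ℝ → ℝ) = Function.invFun F :=
    funext fun x => hF.strictMono.injective <| by
      rw [hF.apply_invFun]; exact e.apply_symm_apply x
  have hs : ContDiff ℝ ∞ (Function.invFun F) := by
    rw [← he]
    exact e.contDiff_symm_deriv (f' := deriv F) (fun x => (hF.deriv_pos x).ne')
      (fun x => (hF.differentiable x).hasDerivAt) hF.contDiff
  refine ⟨hs, fun x => ?_, fun x => ?_⟩
  · have h1 : HasDerivAt (Function.invFun F) (deriv (Function.invFun F) x) x :=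
      ((hs.differentiable (by simp)) x).hasDerivAt
    have h2 := (hF.differentiable (Function.invFun F x)).hasDerivAt.comp x h1
    have h3 : F ∘ Function.invFun F = id := funext hF.apply_invFun
    rw [h3] at h2
    have h4 := h2.unique (hasDerivAt_id x)
    exact pos_of_mul_pos_right (by rw [h4]; exact one_pos) (hF.deriv_pos _).le
  · apply hF.strictMono.injective
    rw [hF.apply_invFun, hF.map_add_one, hF.apply_invFun]

theorem comp (hF : IsDiffeoLift F) (hG : IsDiffeoLift G) : IsDiffeoLift (F ∘ G) := by
  refine ⟨hF.contDiff.comp hG.contDiff, fun x => ?_, fun x => ?_⟩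
  · rw [deriv_comp _ (hF.differentiable _) (hG.differentiable _)]
    exact mul_pos (hF.deriv_pos _) (hG.deriv_pos _)
  · simp [hG.map_add_one, hF.map_add_one]

theorem add_const (c : ℝ) : IsDiffeoLift fun x => x + c :=
  ⟨by fun_prop, fun x => by simp, fun x => by ring⟩

theorem id : IsDiffeoLift id := by simpa [Function.id_def] using add_const 0

theorem invFun_comp (hF : IsDiffeoLift F) (hG : IsDiffeoLift G) :
    Function.invFun (F ∘ G) = Function.invFun G ∘ Function.invFun F :=
  (hF.comp hG).invFun_eq fun x => by simp [hF.apply_invFun, hG.apply_invFun]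

theorem invFun_zero (hF : IsDiffeoLift F) (h : F 0 = 0) : Function.invFun F 0 = 0 := by
  simpa [h] using hF.invFun_apply 0

/-- Lets norms taken over `[0, 1]` bound derivatives on the whole line. It fails at order 0, which
is why later bounds ask for `1 ≤ i`. -/
theorem periodic_iteratedDeriv (hF : IsDiffeoLift F) {i : ℕ} (hi : 1 ≤ i) :
    Function.Periodic (iteratedDeriv i F) 1 := fun x => by
  have h : (fun x => F (x + 1)) = fun x => 1 + F x :=
    funext fun x => by rw [hF.map_add_one, add_comm]
  have := iteratedDeriv_comp_add_const i F 1
  rw [h] at this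
  rw [← congrFun this x, iteratedDeriv_const_add hi 1]

end IsDiffeoLift

/-! ### `C^k` norms of lifts and the conjugation estimate. -/

section Norms

variable {F G : ℝ → ℝ} {k : ℕ}

theorem bddAbove_ckNorm (hF : ContDiff ℝ ∞ F) :
    BddAbove {y : ℝ | ∃ i ≤ k, ∃ x ∈ Icc (0 : ℝ) 1, y = |iteratedDeriv i F x|} := by
  have : {y : ℝ | ∃ i ≤ k, ∃ x ∈ Icc (0 : ℝ) 1, y = |iteratedDeriv i F x|} =
      ⋃ i ∈ Iic k, (fun x => |iteratedDeriv i F x|) '' Icc 0 1 := by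
    ext y
    simp only [mem_ofPred_eq, mem_iUnion, mem_image, mem_Iic, exists_prop]
    exact exists_congr fun i => and_congr_right fun _ =>
      exists_congr fun x => and_congr_right fun _ => eq_comm
  rw [this]
  refine (Set.finite_Iic k).bddAbove_biUnion.2 fun i _ => ?_
  exact (isCompact_Icc.image (hF.continuous_iteratedDeriv i (by exact_mod_cast le_top)).abs).bddAbove

theorem abs_iteratedDeriv_le_ckNorm (hF : ContDiff ℝ ∞ F) {i : ℕ} (hi : i ≤ k) {x : ℝ}
    (hx : x ∈ Icc (0 : ℝ) 1) : |iteratedDeriv i F x| ≤ ckNorm k F :=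
  le_csSup (bddAbove_ckNorm hF) ⟨i, hi, x, hx, rfl⟩

theorem ckNorm_nonneg (k : ℕ) (F : ℝ → ℝ) : 0 ≤ ckNorm k F :=
  Real.sSup_nonneg fun y hy => by
    obtain ⟨i, _, x, _, rfl⟩ := hy
    exact abs_nonneg _

theorem ckNorm_le {c : ℝ} (hc : 0 ≤ c) (h : ∀ i ≤ k, ∀ x, |iteratedDeriv i F x| ≤ c) :
    ckNorm k F ≤ c :=
  Real.sSup_le (fun y hy => by
    obtain ⟨i, hi, x, _, rfl⟩ := hy
    exact h i hi x) hc

theorem ckDist_nonneg (k : ℕ) (F G : ℝ → ℝ) : 0 ≤ ckDist k F G :=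
  (ckNorm_nonneg _ _).trans (le_max_left _ _)

namespace IsDiffeoLift

theorem abs_iteratedDeriv_le_ckNorm (hF : IsDiffeoLift F) {i : ℕ} (hi1 : 1 ≤ i) (hi : i ≤ k)
    (x : ℝ) : |iteratedDeriv i F x| ≤ ckNorm k F := by
  obtain ⟨y, hy, hxy⟩ := (hF.periodic_iteratedDeriv hi1).exists_mem_Ico₀ one_pos x
  rw [hxy]
  exact AbC.abs_iteratedDeriv_le_ckNorm hF.contDiff hi ⟨hy.1, hy.2.le⟩

theorem abs_iteratedDeriv_le_ckSize (hF : IsDiffeoLift F) {i : ℕ} (hi1 : 1 ≤ i) (hi : i ≤ k)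
    (x : ℝ) : |iteratedDeriv i F x| ≤ ckSize k F :=
  (hF.abs_iteratedDeriv_le_ckNorm hi1 hi x).trans (le_max_left _ _)

theorem abs_iteratedDeriv_invFun_le_ckSize (hF : IsDiffeoLift F) {i : ℕ} (hi1 : 1 ≤ i)
    (hi : i ≤ k) (x : ℝ) : |iteratedDeriv i (Function.invFun F) x| ≤ ckSize k F :=
  (hF.invFun.abs_iteratedDeriv_le_ckNorm hi1 hi x).trans (le_max_right _ _)

theorem one_le_ckSize (hF : IsDiffeoLift F) (h0 : F 0 = 0) : 1 ≤ ckSize k F := by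
  have h1 : F 1 = 1 := by simpa [h0] using hF.map_add_one 0
  have := AbC.abs_iteratedDeriv_le_ckNorm hF.contDiff (Nat.zero_le k)
    (x := 1) ⟨zero_le_one, le_rfl⟩
  rw [iteratedDeriv_zero, h1, abs_one] at this
  exact this.trans (le_max_left _ _)

theorem ckSize_mono (hF : IsDiffeoLift F) {l : ℕ} (h : k ≤ l) : ckSize k F ≤ ckSize l F := by
  have key : ∀ G, IsDiffeoLift G → ckNorm k G ≤ ckNorm l G := fun G hG =>
    csSup_le_csSup (bddAbove_ckNorm hG.contDiff) ⟨_, 0, Nat.zero_le _, 0, by simp, rfl⟩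
      fun y ⟨i, hi, x, hx, e⟩ => ⟨i, hi.trans h, x, hx, e⟩
  exact max_le_max (key F hF) (key _ hF.invFun)

theorem abs_iteratedDeriv_sub_le (hF : IsDiffeoLift F) {i : ℕ} (hi : i + 1 ≤ k) (x y : ℝ) :
    |iteratedDeriv i F x - iteratedDeriv i F y| ≤ ckSize k F * |x - y| := by
  have hd : Differentiable ℝ (iteratedDeriv i F) :=
    hF.contDiff.differentiable_iteratedDeriv i (by exact_mod_cast WithTop.coe_lt_top _)
  have := convex_univ.norm_image_sub_le_of_norm_deriv_le (f := iteratedDeriv i F)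
    (C := ckSize k F) (fun x _ => hd x) (fun x _ => by
      rw [← iteratedDeriv_succ, Real.norm_eq_abs]
      exact hF.abs_iteratedDeriv_le_ckSize (Nat.succ_pos i) hi x) (mem_univ y) (mem_univ x)
  simpa only [Real.norm_eq_abs] using this

theorem abs_sub_le (hF : IsDiffeoLift F) (hk : 1 ≤ k) (x y : ℝ) :
    |F x - F y| ≤ ckSize k F * |x - y| := by
  simpa using hF.abs_iteratedDeriv_sub_le (i := 0) (by simpa using hk) x y

/-- The key estimate of the approximation by conjugation method. -/
theorem abs_iteratedDeriv_conj_sub_le (hF : IsDiffeoLift F) (h0 : F 0 = 0) {i : ℕ} (hi : i ≤ k)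
    (β γ x : ℝ) :
    |iteratedDeriv i (fun x => F (Function.invFun F x + β) - F (Function.invFun F x + γ)) x| ≤
      (k.factorial : ℝ) * (ckSize (k + 1) F ^ (k + 1) * |β - γ|) := by
  set S := ckSize (k + 1) F with hS
  have hS1 : 1 ≤ S := hF.one_le_ckSize h0
  set g : ℝ → ℝ := fun x => F (x + β) - F (x + γ)
  have hgβ : ContDiff ℝ ∞ fun x => F (x + β) := (hF.comp (add_const β)).contDiff
  have hgγ : ContDiff ℝ ∞ fun x => F (x + γ) := (hF.comp (add_const γ)).contDiff
  have hg : ContDiff ℝ ∞ g := hgβ.sub hgγ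
  -- Faà di Bruno bound for `g ∘ F⁻¹`. The mean value theorem supplies the small factor `|β - γ|` in
  -- `C` at the cost of one derivative, whence order `k + 1` in `S`.
  have := norm_iteratedFDeriv_comp_le hg hF.invFun.contDiff
    (n := i) (by exact_mod_cast le_top) x (C := S * |β - γ|) (D := S) (fun j hj => by
      rw [norm_iteratedFDeriv_eq_norm_iteratedDeriv, Real.norm_eq_abs]
      have e : iteratedDeriv j g (Function.invFun F x) =
          iteratedDeriv j F (Function.invFun F x + β) -
          iteratedDeriv j F (Function.invFun F x + γ) := by
        rw [iteratedDeriv_fun_sub (hgβ.contDiffAt.of_le (by exact_mod_cast le_top))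
          (hgγ.contDiffAt.of_le (by exact_mod_cast le_top)),
          iteratedDeriv_comp_add_const, iteratedDeriv_comp_add_const]
      rw [e]
      refine (hF.abs_iteratedDeriv_sub_le (k := k + 1) (by omega) _ _).trans_eq ?_
      rw [add_sub_add_left_eq_sub]) (fun j hj1 hj => by
      rw [norm_iteratedFDeriv_eq_norm_iteratedDeriv, Real.norm_eq_abs]
      exact (hF.abs_iteratedDeriv_invFun_le_ckSize hj1 (by omega) x).trans
        (le_self_pow₀ hS1 (by omega)))
  rw [norm_iteratedFDeriv_eq_norm_iteratedDeriv, Real.norm_eq_abs] at this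
  refine this.trans ?_
  have h1 : (i.factorial : ℝ) ≤ k.factorial := by exact_mod_cast Nat.factorial_le hi
  have h2 : S ^ i ≤ S ^ k := pow_le_pow_right₀ hS1 hi
  calc (i.factorial : ℝ) * (S * |β - γ|) * S ^ i ≤ k.factorial * (S * |β - γ|) * S ^ k := by gcongr
    _ = _ := by ring

end IsDiffeoLift

end Norms


/-! ### The sequence of periods -/

namespace IsChoice

variable {ψ : ℝ → ℝ} {α : ℝ} {p : ℕ → ℤ} {q : ℕ → ℕ}

theorem ten_le (h : IsChoice ψ α p q) {n : ℕ} (hn : 1 ≤ n) : 10 ≤ q n := by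
  induction n, hn using Nat.le_induction with
  | base => exact h.start
  | succ n hn ih => exact (ih.trans (Nat.le_self_pow (by omega) _)).trans (h.growth n hn)

theorem ten_mul_le (h : IsChoice ψ α p q) {n : ℕ} (hn : 1 ≤ n) : 10 * q n ≤ q (n + 1) := by
  have h1 := h.ten_le hn
  calc 10 * q n ≤ q n * q n := Nat.mul_le_mul_right _ h1
    _ = q n ^ 2 := (sq _).symm
    _ ≤ q n ^ (2 * n) := Nat.pow_le_pow_right (by omega) (by omega)
    _ ≤ q (n + 1) := h.growth n hn

theorem ten_pow_le (h : IsChoice ψ α p q) {n : ℕ} (hn : 1 ≤ n) : 10 ^ n ≤ q n := by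
  induction n, hn using Nat.le_induction with
  | base => simpa using h.start
  | succ n hn ih =>
    rw [pow_succ, mul_comm]
    exact (Nat.mul_le_mul_left 10 ih).trans (h.ten_mul_le hn)

theorem cast_pos (h : IsChoice ψ α p q) {n : ℕ} (hn : 1 ≤ n) : (0 : ℝ) < q n := by
  have := h.ten_le hn
  exact_mod_cast (by omega : 0 < q n)

theorem tSeq_mul_pow (h : IsChoice ψ α p q) {n : ℕ} (hn : 1 ≤ n) :
    tSeq q n * (q n : ℝ) ^ (2 * n) = q n := by
  have hq := (h.cast_pos hn).ne'
  rw [tSeq, ← zpow_natCast, ← zpow_add₀ hq]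
  push_cast
  rw [sub_add_cancel, zpow_one]

theorem tSeq_pos (h : IsChoice ψ α p q) {n : ℕ} (hn : 1 ≤ n) : 0 < tSeq q n :=
  zpow_pos (h.cast_pos hn) _

theorem tSeq_le_inv (h : IsChoice ψ α p q) {n : ℕ} (hn : 1 ≤ n) : tSeq q n ≤ (q n : ℝ)⁻¹ := by
  rw [tSeq, ← zpow_neg_one]
  have := h.ten_le hn
  exact zpow_le_zpow_right₀ (by exact_mod_cast (by omega : 1 ≤ q n)) (by omega)

theorem inv_le_pow (h : IsChoice ψ α p q) {n : ℕ} (hn : 1 ≤ n) :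
    (q n : ℝ)⁻¹ ≤ (1 / 10 : ℝ) ^ n := by
  rw [one_div, inv_pow]
  exact inv_anti₀ (by positivity) (by exact_mod_cast h.ten_pow_le hn)

theorem tSeq_le (h : IsChoice ψ α p q) {n : ℕ} (hn : 1 ≤ n) : tSeq q n ≤ 1 / 10 := by
  refine (h.tSeq_le_inv hn).trans ?_
  rw [one_div]
  exact inv_anti₀ (by norm_num) (by exact_mod_cast h.ten_le hn)

/-- This is the growth condition rewritten. It makes a displacement of order `1/q_{n+1}` no larger
than `t_n/q_n`, the width of the neighbourhoods at stage `n`. -/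
theorem div_le_tSeq (h : IsChoice ψ α p q) {n : ℕ} (hn : 1 ≤ n) :
    (q n : ℝ) / q (n + 1) ≤ tSeq q n := by
  rw [div_le_iff₀ (h.cast_pos (by omega)), ← h.tSeq_mul_pow hn]
  exact mul_le_mul_of_nonneg_left (by exact_mod_cast h.growth n hn) (h.tSeq_pos hn).le

end IsChoice

/-! ### The lifted building blocks -/

/-- `x` lies within `r / q` of the translate of `q⁻¹ ℤ` by `c / q`. -/
def IsNear (q : ℕ) (c r x : ℝ) : Prop := ∃ k : ℤ, |q * x - c - k| ≤ r

section Cover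

variable {ψ : ℝ → ℝ} {q : ℕ → ℕ} {n : ℕ}

/-- The formula for one cell extends a distance `t` to the left of it because the building block is
the identity near both endpoints. This overlap yields smoothness at the points of `q⁻¹ℤ`. -/
theorem hCover_eq (hψ : IsSmoothStep ψ) (ht : 0 < tSeq q n) (ht' : tSeq q n ≤ 1 / 10) {x : ℝ}
    {m : ℤ} (h1 : m - tSeq q n < q n * x) (h2 : q n * x < m + 1) :
    hCover ψ q n x = (m + hHatSmooth ψ (tSeq q n) (q n * x - m)) / q n := by
  rw [hCover, hHat_eq_hHatSmooth hψ ht ht']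
  rcases le_or_gt (m : ℝ) (q n * x) with h | h
  · have : ⌊(q n : ℝ) * x⌋ = m := Int.floor_eq_iff.2 ⟨h, h2⟩
    rw [Int.fract, this]
  · have : ⌊(q n : ℝ) * x⌋ = m - 1 := Int.floor_eq_iff.2
      ⟨by push_cast; linarith, by push_cast; linarith⟩
    rw [Int.fract, this, hHatSmooth_eq_self_of_ge hψ ht ht' (by push_cast; linarith),
      hHatSmooth_eq_self_of_le hψ ht ht' (by linarith)]
    push_cast
    ring

theorem hCover_eq_floor (hψ : IsSmoothStep ψ) (ht : 0 < tSeq q n) (ht' : tSeq q n ≤ 1 / 10)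
    (x : ℝ) : hCover ψ q n x = (⌊(q n : ℝ) * x⌋ +
      hHatSmooth ψ (tSeq q n) (Int.fract ((q n : ℝ) * x))) / q n := by
  rw [hCover, hHat_eq_hHatSmooth hψ ht ht']

theorem hCover_eventuallyEq (hψ : IsSmoothStep ψ) (ht : 0 < tSeq q n)
    (ht' : tSeq q n ≤ 1 / 10) (x : ℝ) :
    hCover ψ q n =ᶠ[𝓝 x] fun y => ((⌊(q n : ℝ) * x⌋ : ℝ) +
      hHatSmooth ψ (tSeq q n) (q n * y - (⌊(q n : ℝ) * x⌋ : ℝ))) / q n := by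
  have hc : ContinuousAt (fun y : ℝ => (q n : ℝ) * y) x := by fun_prop
  filter_upwards [hc.eventually (Ioo_mem_nhds
    (a := (⌊(q n : ℝ) * x⌋ : ℝ) - tSeq q n) (b := (⌊(q n : ℝ) * x⌋ : ℝ) + 1)
    (by linarith [Int.floor_le ((q n : ℝ) * x)]) (Int.lt_floor_add_one _))] with y hy
  exact hCover_eq hψ ht ht' hy.1 hy.2

theorem hCover_add_div (hq : 0 < q n) (x : ℝ) (p : ℤ) :
    hCover ψ q n (x + p / q n) = hCover ψ q n x + p / q n := by
  have hq' : (q n : ℝ) ≠ 0 := by positivity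
  rw [hCover, hCover, mul_add, mul_div_cancel₀ _ hq', Int.floor_add_intCast,
    Int.fract_add_intCast]
  push_cast
  ring

theorem isDiffeoLift_hCover (hψ : IsSmoothStep ψ) (hq : 0 < q n) (ht : 0 < tSeq q n)
    (ht' : tSeq q n ≤ 1 / 10) : IsDiffeoLift (hCover ψ q n) := by
  have hq' : (0 : ℝ) < q n := by exact_mod_cast hq
  refine ⟨contDiff_iff_contDiffAt.2 fun x => ?_, fun x => ?_, fun x => ?_⟩
  · refine ContDiffAt.congr_of_eventuallyEq ?_ (hCover_eventuallyEq hψ ht ht' x)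
    have : ContDiff ℝ ∞ fun y : ℝ => hHatSmooth ψ (tSeq q n) (q n * y - (⌊(q n : ℝ) * x⌋ : ℝ)) :=
      (contDiff_hHatSmooth hψ _).comp (by fun_prop)
    exact ((contDiff_const.add this).div_const _).contDiffAt
  · rw [(hCover_eventuallyEq hψ ht ht' x).deriv_eq]
    have h1 : HasDerivAt (fun y : ℝ => q n * y - (⌊(q n : ℝ) * x⌋ : ℝ)) (q n) x := by
      simpa using ((hasDerivAt_id x).const_mul (q n : ℝ)).sub_const (⌊(q n : ℝ) * x⌋ : ℝ)
    have h2 := (((contDiff_hHatSmooth hψ (tSeq q n)).differentiable (by simp))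
      (q n * x - (⌊(q n : ℝ) * x⌋ : ℝ))).hasDerivAt.comp x h1
    have h3 := ((h2.const_add (⌊(q n : ℝ) * x⌋ : ℝ)).div_const (q n : ℝ)).deriv
    simp only [Function.comp_def] at h3
    rw [h3]
    exact div_pos (mul_pos (deriv_hHatSmooth_pos hψ ht ht' _) hq') hq'
  · have := hCover_add_div (ψ := ψ) (n := n) hq x (q n : ℤ)
    simpa [hq'.ne'] using this

theorem hCover_zero (hψ : IsSmoothStep ψ) (ht : 0 < tSeq q n) (ht' : tSeq q n ≤ 1 / 10) :
    hCover ψ q n 0 = 0 := by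
  rw [hCover_eq_floor hψ ht ht']
  simp [hHatSmooth_eq_self_of_le hψ ht ht' ht.le]

theorem hHatSmooth_mem_Icc (hψ : IsSmoothStep ψ) {t : ℝ} (ht : 0 < t) (ht' : t ≤ 1 / 10) {y : ℝ}
    (hy : y ∈ Icc (0 : ℝ) 1) : hHatSmooth ψ t y ∈ Icc (0 : ℝ) 1 := by
  have hm := (strictMono_hHatSmooth hψ ht ht').monotone
  constructor
  · rw [← hHatSmooth_eq_self_of_le hψ ht ht' ht.le]; exact hm hy.1
  · rw [← hHatSmooth_eq_self_of_ge hψ ht ht' (by linarith : 1 - t ≤ 1)]; exact hm hy.2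

theorem abs_hCover_sub_le (hψ : IsSmoothStep ψ) (hq : 0 < q n) (ht : 0 < tSeq q n)
    (ht' : tSeq q n ≤ 1 / 10) (x : ℝ) : |hCover ψ q n x - x| ≤ (q n : ℝ)⁻¹ := by
  have hq' : (0 : ℝ) < q n := by exact_mod_cast hq
  have h0 := Int.fract_nonneg ((q n : ℝ) * x)
  have h1 := (Int.fract_lt_one ((q n : ℝ) * x)).le
  have h2 := hHatSmooth_mem_Icc hψ ht ht' ⟨h0, h1⟩
  have e : hCover ψ q n x - x = (hHatSmooth ψ (tSeq q n) (Int.fract ((q n : ℝ) * x)) -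
      Int.fract ((q n : ℝ) * x)) * (q n : ℝ)⁻¹ := by
    rw [hCover_eq_floor hψ ht ht']
    field_simp
    linarith [Int.floor_add_fract ((q n : ℝ) * x)]
  rw [e, abs_mul, abs_of_pos (inv_pos.2 hq')]
  refine mul_le_of_le_one_left (inv_pos.2 hq').le (abs_le.2 ⟨?_, ?_⟩)
  · linarith [h2.1]
  · linarith [h2.2]

theorem isNear_hCover_or (hψ : IsSmoothStep ψ) (hq : 0 < q n) (ht : 0 < tSeq q n)
    (ht' : tSeq q n ≤ 1 / 10) (x : ℝ) :
    IsNear (q n) 0 (5 * tSeq q n) (hCover ψ q n x) ∨ IsNear (q n) (1 / 2) (5 * tSeq q n) x := by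
  have hq' : (0 : ℝ) < q n := by exact_mod_cast hq
  set t := tSeq q n with ht_def
  have h0 := Int.fract_nonneg ((q n : ℝ) * x)
  have h1 := (Int.fract_lt_one ((q n : ℝ) * x)).le
  have h2 := hHatSmooth_mem_Icc hψ ht ht' ⟨h0, h1⟩
  have hm := (strictMono_hHatSmooth hψ ht ht').monotone
  have e : q n * hCover ψ q n x = ⌊(q n : ℝ) * x⌋ +
      hHatSmooth ψ t (Int.fract ((q n : ℝ) * x)) := by
    rw [hCover_eq_floor hψ ht ht', mul_div_cancel₀ _ hq'.ne']
  have hfr := Int.floor_add_fract ((q n : ℝ) * x)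
  rcases le_total (Int.fract ((q n : ℝ) * x)) ((1 - t + 10 * t ^ 2) / 2) with h | h
  · left
    have := hm h
    rw [hHatSmooth_left hψ ht ht'] at this
    refine ⟨⌊(q n : ℝ) * x⌋, abs_le.2 ⟨?_, ?_⟩⟩ <;> rw [e] <;> linarith [h2.1]
  rcases le_total ((1 + t - 10 * t ^ 2) / 2) (Int.fract ((q n : ℝ) * x)) with h' | h'
  · left
    have := hm h'
    rw [hHatSmooth_right hψ ht ht'] at this
    refine ⟨⌊(q n : ℝ) * x⌋ + 1, abs_le.2 ⟨?_, ?_⟩⟩ <;> rw [e] <;> push_cast <;> linarith [h2.2]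
  -- Here the fractional part is within `t/2` of `1/2`; the weaker radius `5t` is used so that the
  -- two alternatives match when the map is inverted.
  · right
    refine ⟨⌊(q n : ℝ) * x⌋, abs_le.2 ⟨?_, ?_⟩⟩ <;> nlinarith

end Cover

/-! ### The conjugating diffeomorphisms -/

namespace IsChoice

variable {ψ : ℝ → ℝ} {α : ℝ} {p : ℕ → ℤ} {q : ℕ → ℕ} {n : ℕ}

theorem isDiffeoLift_hCover (h : IsChoice ψ α p q) (hψ : IsSmoothStep ψ) (hn : 1 ≤ n) :
    IsDiffeoLift (hCover ψ q n) :=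
  AbC.isDiffeoLift_hCover hψ (by linarith [h.ten_le hn]) (h.tSeq_pos hn) (h.tSeq_le hn)

theorem isDiffeoLift_hConj (h : IsChoice ψ α p q) (hψ : IsSmoothStep ψ) (a : ℕ → Bool)
    (hn : 1 ≤ n) : IsDiffeoLift (hConj ψ q a n) := by
  unfold hConj
  split_ifs
  · exact h.isDiffeoLift_hCover hψ hn
  · exact (h.isDiffeoLift_hCover hψ hn).invFun

theorem hConj_zero (h : IsChoice ψ α p q) (hψ : IsSmoothStep ψ) (a : ℕ → Bool)
    (hn : 1 ≤ n) : hConj ψ q a n 0 = 0 := by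
  have := hCover_zero hψ (h.tSeq_pos hn) (h.tSeq_le hn)
  unfold hConj
  split_ifs
  · exact this
  · exact (h.isDiffeoLift_hCover hψ hn).invFun_zero this

theorem hConj_add_alphaSeq (h : IsChoice ψ α p q) (hψ : IsSmoothStep ψ) (a : ℕ → Bool)
    (hn : 1 ≤ n) (x : ℝ) :
    hConj ψ q a n (x + alphaSeq p q n) = hConj ψ q a n x + alphaSeq p q n := by
  have hq : 0 < q n := by linarith [h.ten_le hn]
  have hd := h.isDiffeoLift_hCover hψ hn
  unfold hConj alphaSeq
  split_ifs
  · exact hCover_add_div hq x _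
  · apply hd.strictMono.injective
    rw [hd.apply_invFun, hCover_add_div hq, hd.apply_invFun]

theorem abs_hConj_sub_le (h : IsChoice ψ α p q) (hψ : IsSmoothStep ψ) (a : ℕ → Bool)
    (hn : 1 ≤ n) (x : ℝ) : |hConj ψ q a n x - x| ≤ (q n : ℝ)⁻¹ := by
  have hd := h.isDiffeoLift_hCover hψ hn
  have key := abs_hCover_sub_le hψ (by linarith [h.ten_le hn]) (h.tSeq_pos hn) (h.tSeq_le hn)
  unfold hConj
  split_ifs
  · exact key x
  · have := key (Function.invFun (hCover ψ q n) x)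
    rwa [hd.apply_invFun, abs_sub_comm] at this

theorem abs_invFun_hConj_sub_le (h : IsChoice ψ α p q) (hψ : IsSmoothStep ψ) (a : ℕ → Bool)
    (hn : 1 ≤ n) (x : ℝ) : |Function.invFun (hConj ψ q a n) x - x| ≤ (q n : ℝ)⁻¹ := by
  have := h.abs_hConj_sub_le hψ a hn (Function.invFun (hConj ψ q a n) x)
  rwa [(h.isDiffeoLift_hConj hψ a hn).apply_invFun, abs_sub_comm] at this

/-- Each `h_{a,n}` maps the complement of a small neighbourhood of a finite set of the circle
into a small neighbourhood of another one. -/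
theorem exists_isNear_hConj (h : IsChoice ψ α p q) (hψ : IsSmoothStep ψ) (a : ℕ → Bool)
    (hn : 1 ≤ n) : ∃ c ∈ Icc (0 : ℝ) 1, ∃ c' ∈ Icc (0 : ℝ) 1, ∀ x,
      IsNear (q n) c (5 * tSeq q n) x ∨ IsNear (q n) c' (5 * tSeq q n) (hConj ψ q a n x) := by
  have hd := h.isDiffeoLift_hCover hψ hn
  have key := isNear_hCover_or hψ (by linarith [h.ten_le hn]) (h.tSeq_pos hn) (h.tSeq_le hn)
  unfold hConj
  split_ifs
  · exact ⟨1 / 2, by norm_num, 0, by norm_num, fun x => (key x).symm⟩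
  · refine ⟨0, by norm_num, 1 / 2, by norm_num, fun x => ?_⟩
    have := key (Function.invFun (hCover ψ q n) x)
    rwa [hd.apply_invFun] at this

theorem isDiffeoLift_HConj (h : IsChoice ψ α p q) (hψ : IsSmoothStep ψ) (a : ℕ → Bool) (n : ℕ) :
    IsDiffeoLift (HConj ψ q a n) := by
  induction n with
  | zero => exact IsDiffeoLift.id
  | succ n ih => exact ih.comp (h.isDiffeoLift_hConj hψ a (by omega))

theorem HConj_zero (h : IsChoice ψ α p q) (hψ : IsSmoothStep ψ) (a : ℕ → Bool) (n : ℕ) :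
    HConj ψ q a n 0 = 0 := by
  induction n with
  | zero => rfl
  | succ n ih => simp [HConj, h.hConj_zero hψ a (Nat.succ_pos n), ih]

theorem invFun_HConj_succ (h : IsChoice ψ α p q) (hψ : IsSmoothStep ψ) (a : ℕ → Bool) (n : ℕ)
    (x : ℝ) : Function.invFun (HConj ψ q a (n + 1)) x =
      Function.invFun (hConj ψ q a (n + 1)) (Function.invFun (HConj ψ q a n) x) := by
  rw [HConj, (h.isDiffeoLift_HConj hψ a n).invFun_comp (h.isDiffeoLift_hConj hψ a (by omega))]
  rfl

/-- The number `|||H_{a,n}|||_{n+1}` which controls the choice of `α_n`. -/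
def size (ψ : ℝ → ℝ) (q : ℕ → ℕ) (a : ℕ → Bool) (n : ℕ) : ℝ := ckSize (n + 1) (HConj ψ q a n)

theorem one_le_size (h : IsChoice ψ α p q) (hψ : IsSmoothStep ψ) (a : ℕ → Bool) (n : ℕ) :
    1 ≤ size ψ q a n :=
  (h.isDiffeoLift_HConj hψ a n).one_le_ckSize (h.HConj_zero hψ a n)

theorem abs_HConj_sub_le (h : IsChoice ψ α p q) (hψ : IsSmoothStep ψ) (a : ℕ → Bool) (n : ℕ)
    (x y : ℝ) : |HConj ψ q a n x - HConj ψ q a n y| ≤ size ψ q a n * |x - y| :=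
  (h.isDiffeoLift_HConj hψ a n).abs_sub_le (by omega) x y

/-! ### Arithmetic of the `α_n` and the summable error bounds. -/

theorem abs_alphaSeq_sub_lt (h : IsChoice ψ α p q) (a : ℕ → Bool) (hn : 1 ≤ n) :
    |alphaSeq p q (n + 1) - alphaSeq p q n| < 1 / ((n : ℝ) ^ 2 * size ψ q a n ^ (n + 1)) := by
  have h1 := h.closer n hn
  have h2 := h.close n hn a
  have h3 : |alphaSeq p q (n + 1) - alphaSeq p q n| ≤
      |α - alphaSeq p q n| + |α - alphaSeq p q (n + 1)| := by
    rw [show alphaSeq p q (n + 1) - alphaSeq p q n =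
      (α - alphaSeq p q n) - (α - alphaSeq p q (n + 1)) by ring]
    exact abs_sub _ _
  have e : 1 / ((n : ℝ) ^ 2 * size ψ q a n ^ (n + 1)) =
      2 * (1 / (2 * (n : ℝ) ^ 2 * ckSize (n + 1) (HConj ψ q a n) ^ (n + 1))) := by
    rw [mul_assoc 2, ← size, one_div (2 * _), mul_inv, ← mul_assoc, mul_inv_cancel₀ two_ne_zero,
      one_mul, one_div]
  linarith

theorem inv_mul_le_abs_alphaSeq_sub (h : IsChoice ψ α p q) (hn : 1 ≤ n) :
    1 / ((q n : ℝ) * q (n + 1)) ≤ |alphaSeq p q (n + 1) - alphaSeq p q n| := by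
  have hq := h.cast_pos hn
  have hq' := h.cast_pos (show 1 ≤ n + 1 by omega)
  -- The approximations improve strictly, so consecutive fractions differ and the integer numerator
  -- of their difference is nonzero.
  have hne : alphaSeq p q (n + 1) ≠ alphaSeq p q n := fun e => by
    have := h.closer n hn
    rw [e] at this
    exact this.false
  have e : alphaSeq p q (n + 1) - alphaSeq p q n =
      ((p (n + 1) * q n - q (n + 1) * p n : ℤ) : ℝ) / ((q n : ℝ) * q (n + 1)) := by
    rw [alphaSeq, alphaSeq, div_sub_div _ _ hq'.ne' hq.ne']
    push_cast
    rw [mul_comm (q n : ℝ)]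
  have hz : (p (n + 1) * q n - q (n + 1) * p n : ℤ) ≠ 0 := fun hz => by
    rw [hz, Int.cast_zero, zero_div] at e
    exact hne (sub_eq_zero.1 e)
  rw [e, abs_div, abs_of_pos (mul_pos hq hq')]
  gcongr
  exact_mod_cast Int.one_le_abs hz

/-- From `n² S^{n+1} < q_n q_{n+1}` there are two cases. If `q_n ≤ S^n`, cancelling `S^n` gives
`S/q_{n+1} ≤ 1/n²`. Otherwise `S ≤ S^n < q_n`, and the quotient is at most `q_n/q_{n+1} ≤ t_n ≤
10^{-n}`. -/
theorem size_div_le (h : IsChoice ψ α p q) (hψ : IsSmoothStep ψ) (a : ℕ → Bool) (hn : 1 ≤ n) :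
    size ψ q a n / q (n + 1) ≤ 1 / (n : ℝ) ^ 2 + (1 / 10) ^ n := by
  have hq := h.cast_pos hn
  have hq' := h.cast_pos (show 1 ≤ n + 1 by omega)
  have hS := h.one_le_size hψ a n
  set S := size ψ q a n with hS_def
  have hn' : (0 : ℝ) < (n : ℝ) ^ 2 := by positivity
  have hlt := (h.inv_mul_le_abs_alphaSeq_sub hn).trans_lt (h.abs_alphaSeq_sub_lt a hn)
  have hSp : 0 < S ^ (n + 1) := by positivity
  rw [one_div_lt_one_div (by positivity) (by positivity)] at hlt
  rcases le_or_gt (q n : ℝ) (S ^ n) with hc | hc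
  · have h1 : S / q (n + 1) ≤ 1 / (n : ℝ) ^ 2 := by
      rw [div_le_div_iff₀ hq' hn', one_mul]
      refine le_of_mul_le_mul_left ?_ hq
      calc (q n : ℝ) * (S * (n : ℝ) ^ 2) ≤ S ^ n * (S * (n : ℝ) ^ 2) := by gcongr
        _ = (n : ℝ) ^ 2 * S ^ (n + 1) := by ring
        _ ≤ _ := hlt.le
    exact h1.trans (le_add_of_nonneg_right (by positivity))
  · have h1 : S ≤ q n := (le_self_pow₀ hS (by omega)).trans hc.le
    have h2 : S / q (n + 1) ≤ (q n : ℝ) / q (n + 1) := by gcongr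
    have h3 := (h2.trans (h.div_le_tSeq hn)).trans ((h.tSeq_le_inv hn).trans (h.inv_le_pow hn))
    exact h3.trans (le_add_of_nonneg_left (by positivity))

theorem summable_size_div (h : IsChoice ψ α p q) (hψ : IsSmoothStep ψ) (a : ℕ → Bool) :
    Summable fun n => size ψ q a n / q (n + 1) := by
  rw [← summable_nat_add_iff 1]
  refine Summable.of_nonneg_of_le (fun n => ?_)
    (fun n => h.size_div_le hψ a (Nat.succ_pos n))
    ((summable_nat_add_iff (f := fun n : ℕ => 1 / (n : ℝ) ^ 2 + (1 / 10) ^ n) 1).2 ?_)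
  · have := h.one_le_size hψ a (n + 1)
    positivity
  · exact (Real.summable_one_div_nat_pow.2 one_lt_two).add
      (summable_geometric_of_lt_one (by norm_num) (by norm_num))

theorem summable_tSeq (h : IsChoice ψ α p q) : Summable fun n => tSeq q (n + 1) :=
  Summable.of_nonneg_of_le (fun n => (h.tSeq_pos (Nat.succ_pos n)).le)
    (fun n => (h.tSeq_le_inv (Nat.succ_pos n)).trans (h.inv_le_pow (Nat.succ_pos n)))
    ((summable_nat_add_iff (f := fun n : ℕ => (1 / 10 : ℝ) ^ n) 1).2
      (summable_geometric_of_lt_one (by norm_num) (by norm_num)))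

theorem tendsto_alphaSeq (h : IsChoice ψ α p q) (hψ : IsSmoothStep ψ) :
    Tendsto (alphaSeq p q) atTop (𝓝 α) := by
  rw [tendsto_iff_dist_tendsto_zero]
  refine squeeze_zero' (.of_forall fun n => dist_nonneg) ?_
    (tendsto_one_div_atTop_nhds_zero_nat (𝕜 := ℝ))
  filter_upwards [eventually_ge_atTop 1] with n hn
  rw [dist_comm, Real.dist_eq]
  refine (h.close n hn fun _ => false).le.trans ?_
  have h1 : 1 ≤ ckSize (n + 1) (HConj ψ q (fun _ => false) n) ^ (n + 1) :=
    one_le_pow₀ (h.one_le_size hψ _ n)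
  have hn' : (1 : ℝ) ≤ n := by exact_mod_cast hn
  apply one_div_le_one_div_of_le (by positivity)
  nlinarith [mul_le_mul_of_nonneg_left h1 (by positivity : 0 ≤ 2 * (n : ℝ) ^ 2)]

end IsChoice


/-! ### Limits of fast converging sequences -/

theorem tendstoUniformly_of_abs_sub_le {f : ℕ → ℝ → ℝ} {g : ℝ → ℝ} {e : ℕ → ℝ}
    (he : Tendsto e atTop (𝓝 0)) (h : ∀ᶠ n in atTop, ∀ x, |f n x - g x| ≤ e n) :
    TendstoUniformly f g atTop := by
  rw [Metric.tendstoUniformly_iff]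
  intro ε hε
  filter_upwards [h, he.eventually (gt_mem_nhds hε)] with n hn hn' x
  rw [dist_comm, Real.dist_eq]
  exact (hn x).trans_lt hn'

theorem exists_continuous_limit {f : ℕ → ℝ → ℝ} (hf : ∀ n, Continuous (f n)) {v : ℕ → ℝ}
    (hv : Summable v) (h : ∀ n x, |f (n + 1) x - f n x| ≤ v n) :
    ∃ g : ℝ → ℝ, Continuous g ∧ ∀ n x, |f n x - g x| ≤ ∑' j, v (j + n) := by
  have hd : ∀ x n, dist (f n x) (f n.succ x) ≤ v n := fun x n => by
    rw [dist_comm, Real.dist_eq]; exact h n x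
  have hc : ∀ x, ∃ y, Tendsto (fun n => f n x) atTop (𝓝 y) := fun x =>
    cauchySeq_tendsto_of_complete (cauchySeq_of_dist_le_of_summable v (hd x) hv)
  choose g hg using hc
  have hb : ∀ n x, |f n x - g x| ≤ ∑' j, v (j + n) := fun n x => by
    have := dist_le_tsum_of_dist_le_of_tendsto v (hd x) hv (hg x) n
    rw [Real.dist_eq] at this
    simpa only [add_comm n] using this
  exact ⟨g, (tendstoUniformly_of_abs_sub_le (tendsto_sum_nat_add v)
    (.of_forall hb)).continuous (Frequently.of_forall hf), hb⟩

/-- The limit is a telescoping series. Order `k` is controlled only once `k ≤ n + 1`, which suffices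
since finitely many terms do not affect smoothness; the case `k = 0` holds for all `n` and gives
pointwise convergence. -/
theorem exists_smooth_limit {f : ℕ → ℝ → ℝ} (hf : ∀ n, ContDiff ℝ ∞ (f n)) {v : ℕ → ℕ → ℝ}
    (hv : ∀ k, Summable (v k))
    (h : ∀ k n, k ≤ n + 1 → ∀ i ≤ k, ∀ x,
      |iteratedDeriv i (fun x => f (n + 1) x - f n x) x| ≤ v k n) :
    ∃ g : ℝ → ℝ, ContDiff ℝ ∞ g ∧ ∀ k n, k ≤ n + 1 → ∀ i ≤ k, ∀ x,
      |iteratedDeriv i (fun x => f n x - g x) x| ≤ ∑' j, v k (j + n) := by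
  set d : ℕ → ℝ → ℝ := fun n x => f (n + 1) x - f n x with hd_def
  have hd : ∀ n, ContDiff ℝ ∞ (d n) := fun n => (hf (n + 1)).sub (hf n)
  have hs : ∀ x, Summable fun n => d n x := fun x =>
    Summable.of_norm_bounded (hv 0) fun n => by
      simpa using h 0 n (Nat.zero_le _) 0 le_rfl x
  refine ⟨fun x => f 0 x + ∑' n, d n x, (hf 0).add ?_, fun k n hkn i hi x => ?_⟩
  · refine contDiff_tsum_of_eventually (v := v) hd (fun k _ => hv k) fun k _ => ?_
    rw [Nat.cofinite_eq_atTop]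
    filter_upwards [eventually_ge_atTop k] with n hn x
    rw [norm_iteratedFDeriv_eq_norm_iteratedDeriv, Real.norm_eq_abs]
    exact h k n (by omega) k le_rfl x
  · have e : (fun x => f n x - (f 0 x + ∑' n, d n x)) = fun x => -∑' j, d (j + n) x := by
      funext x
      have h1 := (hs x).sum_add_tsum_nat_add n
      have h2 : ∑ j ∈ Finset.range n, d j x = f n x - f 0 x :=
        Finset.sum_range_sub (fun j => f j x) n
      rw [← h1, h2]
      ring
    have hb : ∀ m j x, m ≤ k → ‖iteratedFDeriv ℝ m (d (j + n)) x‖ ≤ v k (j + n) :=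
      fun m j x hm => by
        rw [norm_iteratedFDeriv_eq_norm_iteratedDeriv, Real.norm_eq_abs]
        exact h k (j + n) (by omega) m hm x
    have hvk : Summable fun j => v k (j + n) := (summable_nat_add_iff n).2 (hv k)
    have h1 := iteratedFDeriv_tsum_apply (𝕜 := ℝ) (N := (k : ℕ∞)) (f := fun j => d (j + n))
      (v := fun _ j => v k (j + n)) (fun j => (hd _).of_le (by exact_mod_cast le_top))
      (fun _ _ => hvk) (fun m j x hm => hb m j x (by exact_mod_cast hm)) (k := i)
      (by exact_mod_cast hi) x
    rw [e, iteratedDeriv_fun_neg, abs_neg, ← Real.norm_eq_abs,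
      ← norm_iteratedFDeriv_eq_norm_iteratedDeriv, h1]
    exact tsum_of_norm_bounded hvk.hasSum fun j => hb i j x hi

/-! ### Lifts of circle homeomorphisms -/

/-- `F` and `G` are lifts of an orientation-preserving circle homeomorphism and its inverse. -/
structure IsLiftPair (F G : ℝ → ℝ) : Prop where
  strictMono : StrictMono F
  continuous : Continuous F
  continuous_inv : Continuous G
  apply_inv : ∀ x, F (G x) = x
  map_add_one : ∀ x, F (x + 1) = F x + 1

namespace IsLiftPair

variable {F G : ℝ → ℝ}

theorem inv_apply (h : IsLiftPair F G) (x : ℝ) : G (F x) = x :=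
  h.strictMono.injective (h.apply_inv _)

theorem inv_add_one (h : IsLiftPair F G) (x : ℝ) : G (x + 1) = G x + 1 :=
  h.strictMono.injective (by rw [h.apply_inv, h.map_add_one, h.apply_inv])

theorem invFun_eq (h : IsLiftPair F G) : Function.invFun F = G := by
  funext x
  nth_rw 1 [← h.apply_inv x]
  exact Function.leftInverse_invFun h.strictMono.injective _

/-- Uniform convergence passes to the compositions in both orders, so the limits are mutually
inverse. Injectivity then upgrades the monotone limit to a strictly monotone one. -/
theorem of_tendstoUniformly {f : ℕ → ℝ → ℝ} (hf : ∀ n, IsDiffeoLift (f n))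
    (hF : TendstoUniformly f F atTop)
    (hG : TendstoUniformly (fun n => Function.invFun (f n)) G atTop) : IsLiftPair F G := by
  have hFc : Continuous F := hF.continuous (Frequently.of_forall fun n => (hf n).continuous)
  have hGc : Continuous G := hG.continuous (Frequently.of_forall fun n => (hf n).invFun.continuous)
  have hGF : ∀ x, G (F x) = x := fun x => by
    have := hG.tendsto_comp hGc.continuousAt (hF.tendsto_at x)
    simp only [(hf _).invFun_apply] at this
    exact tendsto_nhds_unique this tendsto_const_nhds
  refine ⟨Monotone.strictMono_of_injective ?_ (Function.LeftInverse.injective hGF), hFc, hGc,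
    fun x => ?_, fun x => ?_⟩
  · exact fun x y hxy => le_of_tendsto_of_tendsto' (hF.tendsto_at x) (hF.tendsto_at y)
      fun n => (hf n).strictMono.monotone hxy
  · have := hF.tendsto_comp hFc.continuousAt (hG.tendsto_at x)
    simp only [(hf _).apply_invFun] at this
    exact tendsto_nhds_unique this tendsto_const_nhds
  · have := hF.tendsto_at (x + 1)
    simp only [(hf _).map_add_one] at this
    exact tendsto_nhds_unique this ((hF.tendsto_at x).add_const 1)

theorem periodic (h : IsLiftPair F G) :
    Function.Periodic (fun x => ((F x : ℝ) : UnitAddCircle)) 1 := fun x => by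
  simp [h.map_add_one]

theorem periodic_inv (h : IsLiftPair F G) :
    Function.Periodic (fun x => ((G x : ℝ) : UnitAddCircle)) 1 := fun x => by
  simp [h.inv_add_one]

/-- The circle homeomorphism with a given lift. -/
def homeomorph (h : IsLiftPair F G) : UnitAddCircle ≃ₜ UnitAddCircle where
  toFun := h.periodic.lift
  invFun := h.periodic_inv.lift
  left_inv z := by
    induction z using QuotientAddGroup.induction_on with
    | H x => simp [Function.Periodic.lift_coe, h.inv_apply]
  right_inv z := by
    induction z using QuotientAddGroup.induction_on with
    | H x => simp [Function.Periodic.lift_coe, h.apply_inv]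
  continuous_toFun := Continuous.quotient_lift (continuous_quotient_mk'.comp h.continuous) _
  continuous_invFun := Continuous.quotient_lift (continuous_quotient_mk'.comp h.continuous_inv) _

theorem homeomorph_coe (h : IsLiftPair F G) (x : ℝ) :
    h.homeomorph (x : UnitAddCircle) = ((F x : ℝ) : UnitAddCircle) := rfl

theorem isLift (h : IsLiftPair F G) : IsLift F h.homeomorph :=
  ⟨h.strictMono, h.continuous, fun _ => rfl⟩

end IsLiftPair

/-! ### Convergence of the diffeomorphisms `T_{a,n}` and of the maps `H_{a,n}` -/

namespace IsDiffeoLift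

variable {F : ℝ → ℝ}

theorem conj (hF : IsDiffeoLift F) (β : ℝ) :
    IsDiffeoLift fun x => F (Function.invFun F x + β) :=
  hF.comp ((add_const β).comp hF.invFun)

theorem invFun_conj (hF : IsDiffeoLift F) (β : ℝ) :
    Function.invFun (fun x => F (Function.invFun F x + β)) =
      fun x => F (Function.invFun F x + -β) :=
  (hF.conj β).invFun_eq fun x => by simp [hF.invFun_apply, hF.apply_invFun]

end IsDiffeoLift

namespace IsChoice

variable {ψ : ℝ → ℝ} {α : ℝ} {p : ℕ → ℤ} {q : ℕ → ℕ}

/-- An angle commuting with the newest factor does not see it. This rewrites `T_n` as a conjugate by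
`H_{n+1}`, making it comparable with `T_{n+1}`. -/
theorem conj_succ_eq (h : IsChoice ψ α p q) (hψ : IsSmoothStep ψ) (a : ℕ → Bool) (n : ℕ) {β : ℝ}
    (hβ : ∀ x, hConj ψ q a (n + 1) (x + β) = hConj ψ q a (n + 1) x + β) (x : ℝ) :
    HConj ψ q a (n + 1) (Function.invFun (HConj ψ q a (n + 1)) x + β) =
      HConj ψ q a n (Function.invFun (HConj ψ q a n) x + β) := by
  rw [h.invFun_HConj_succ hψ, HConj, Function.comp_apply, hβ,
    (h.isDiffeoLift_hConj hψ a (Nat.succ_pos n)).apply_invFun]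

theorem hConj_add_neg_alphaSeq (h : IsChoice ψ α p q) (hψ : IsSmoothStep ψ) (a : ℕ → Bool)
    {n : ℕ} (hn : 1 ≤ n) (x : ℝ) :
    hConj ψ q a n (x + -alphaSeq p q n) = hConj ψ q a n x + -alphaSeq p q n := by
  have := h.hConj_add_alphaSeq hψ a hn (x + -alphaSeq p q n)
  rw [neg_add_cancel_right] at this
  rw [this, add_neg_cancel_right]

theorem abs_iteratedDeriv_conj_step_le (h : IsChoice ψ α p q) (hψ : IsSmoothStep ψ)
    (a : ℕ → Bool) {k n : ℕ} (hk : k ≤ n + 1) {i : ℕ} (hi : i ≤ k) {β γ : ℝ} (x : ℝ)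
    (hγ : ∀ x, hConj ψ q a (n + 1) (x + γ) = hConj ψ q a (n + 1) x + γ)
    (hβγ : |β - γ| = |alphaSeq p q (n + 1 + 1) - alphaSeq p q (n + 1)|) :
    |iteratedDeriv i (fun x =>
      HConj ψ q a (n + 1) (Function.invFun (HConj ψ q a (n + 1)) x + β) -
        HConj ψ q a n (Function.invFun (HConj ψ q a n) x + γ)) x| ≤
      (k.factorial : ℝ) * (1 / ((n + 1 : ℕ) : ℝ) ^ 2) := by
  have hd := h.isDiffeoLift_HConj hψ a (n + 1)
  have h0 := h.HConj_zero hψ a (n + 1)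
  have hS := h.one_le_size hψ a (n + 1)
  simp only [← h.conj_succ_eq hψ a n hγ]
  refine (hd.abs_iteratedDeriv_conj_sub_le h0 hi β γ x).trans ?_
  refine mul_le_mul_of_nonneg_left ?_ (Nat.cast_nonneg _)
  rw [hβγ]
  have h1 := (h.abs_alphaSeq_sub_lt a (Nat.succ_pos n)).le
  have h2 : ckSize (k + 1) (HConj ψ q a (n + 1)) ^ (k + 1) ≤
      size ψ q a (n + 1) ^ (n + 1 + 1) :=
    (pow_le_pow_left₀ (zero_le_one.trans (hd.one_le_ckSize h0)) (hd.ckSize_mono (by omega)) _).trans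
      (pow_le_pow_right₀ hS (by omega))
  have h3 : 0 < size ψ q a (n + 1) ^ (n + 1 + 1) := by positivity
  calc _ ≤ size ψ q a (n + 1) ^ (n + 1 + 1) *
        (1 / (((n + 1 : ℕ) : ℝ) ^ 2 * size ψ q a (n + 1) ^ (n + 1 + 1))) :=
      mul_le_mul h2 h1 (abs_nonneg _) h3.le
    _ = _ := by field_simp

theorem isDiffeoLift_TApprox (h : IsChoice ψ α p q) (hψ : IsSmoothStep ψ) (a : ℕ → Bool)
    (n : ℕ) : IsDiffeoLift (TApprox ψ p q a n) :=
  (h.isDiffeoLift_HConj hψ a n).conj _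

theorem exists_limit_TApprox (h : IsChoice ψ α p q) (hψ : IsSmoothStep ψ) (a : ℕ → Bool) :
    ∃ F G : ℝ → ℝ, IsLiftPair F G ∧ ContDiff ℝ ∞ F ∧ ContDiff ℝ ∞ G ∧
      TendstoUniformly (TApprox ψ p q a) F atTop ∧
      ∀ k, Tendsto (fun n => ckDist k (TApprox ψ p q a n) F) atTop (𝓝 0) := by
  set v : ℕ → ℕ → ℝ := fun k n => (k.factorial : ℝ) * (1 / ((n + 1 : ℕ) : ℝ) ^ 2)
  have hv : ∀ k, Summable (v k) := fun k =>
    ((summable_nat_add_iff (f := fun n : ℕ => 1 / (n : ℝ) ^ 2) 1).2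
      (Real.summable_one_div_nat_pow.2 one_lt_two)).mul_left _
  have hv0 : ∀ k n, 0 ≤ ∑' j, v k (j + n) := fun k n =>
    tsum_nonneg fun j => by positivity
  have hinv : ∀ n, Function.invFun (TApprox ψ p q a n) = fun x =>
      HConj ψ q a n (Function.invFun (HConj ψ q a n) x + -alphaSeq p q (n + 1)) := fun n =>
    (h.isDiffeoLift_HConj hψ a n).invFun_conj _
  obtain ⟨F, hF, hFb⟩ := exists_smooth_limit (f := TApprox ψ p q a)
    (fun n => (h.isDiffeoLift_TApprox hψ a n).contDiff) hv fun k n hk i hi x =>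
      h.abs_iteratedDeriv_conj_step_le hψ a hk hi x
        (h.hConj_add_alphaSeq hψ a (Nat.succ_pos n)) rfl
  obtain ⟨G, hG, hGb⟩ := exists_smooth_limit
    (f := fun n => Function.invFun (TApprox ψ p q a n))
    (fun n => (h.isDiffeoLift_TApprox hψ a n).invFun.contDiff) hv fun k n hk i hi x => by
      simp only [hinv]
      refine h.abs_iteratedDeriv_conj_step_le hψ a hk hi x
        (h.hConj_add_neg_alphaSeq hψ a (Nat.succ_pos n)) ?_
      rw [neg_sub_neg, abs_sub_comm]
  have hFu : TendstoUniformly (TApprox ψ p q a) F atTop :=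
    tendstoUniformly_of_abs_sub_le (tendsto_sum_nat_add (v 0)) (.of_forall fun n x => by
      simpa using hFb 0 n (Nat.zero_le _) 0 le_rfl x)
  have hGu : TendstoUniformly (fun n => Function.invFun (TApprox ψ p q a n)) G atTop :=
    tendstoUniformly_of_abs_sub_le (tendsto_sum_nat_add (v 0)) (.of_forall fun n x => by
      simpa using hGb 0 n (Nat.zero_le _) 0 le_rfl x)
  have hpair := IsLiftPair.of_tendstoUniformly (h.isDiffeoLift_TApprox hψ a) hFu hGu
  refine ⟨F, G, hpair, hF, hG, hFu, fun k => ?_⟩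
  refine squeeze_zero' (.of_forall fun n => ckDist_nonneg _ _ _) ?_ (tendsto_sum_nat_add (v k))
  filter_upwards [eventually_ge_atTop k] with n hn
  rw [ckDist, hpair.invFun_eq]
  exact max_le (ckNorm_le (hv0 k n) (hFb k n (by omega)))
    (ckNorm_le (hv0 k n) (hGb k n (by omega)))

/-! ### Geometric growth of the periods and uniform convergence of the `H_{a,n}`. -/

theorem pow_mul_le (h : IsChoice ψ α p q) {n : ℕ} (hn : 1 ≤ n) (j : ℕ) :
    10 ^ j * q n ≤ q (j + n) := by
  induction j with
  | zero => simp
  | succ j ih =>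
    rw [pow_succ', mul_assoc, add_right_comm]
    exact (Nat.mul_le_mul_left 10 ih).trans (h.ten_mul_le (by omega))

theorem inv_add_le (h : IsChoice ψ α p q) {n : ℕ} (hn : 1 ≤ n) (j : ℕ) :
    (q (j + n) : ℝ)⁻¹ ≤ (1 / 10 : ℝ) ^ j * (q n : ℝ)⁻¹ := by
  rw [one_div, inv_pow, ← mul_inv]
  have := h.cast_pos hn
  exact inv_anti₀ (by positivity) (by exact_mod_cast h.pow_mul_le hn j)

theorem summable_inv (h : IsChoice ψ α p q) : Summable fun j => (q (j + 1) : ℝ)⁻¹ :=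
  Summable.of_nonneg_of_le (fun j => by positivity) (fun j => h.inv_add_le le_rfl j)
    ((summable_geometric_of_lt_one (by norm_num) (by norm_num)).mul_right _)

theorem tsum_inv_le (h : IsChoice ψ α p q) (n : ℕ) :
    ∑' j, (q (j + n + 1) : ℝ)⁻¹ ≤ 2 / q (n + 1) := by
  have hg : HasSum (fun j => (1 / 10 : ℝ) ^ j * (q (n + 1) : ℝ)⁻¹)
      ((1 - 1 / 10 : ℝ)⁻¹ * (q (n + 1) : ℝ)⁻¹) :=
    (hasSum_geometric_of_lt_one (by norm_num) (by norm_num)).mul_right _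
  have hle : ∑' j, (q (j + n + 1) : ℝ)⁻¹ ≤ (1 - 1 / 10 : ℝ)⁻¹ * (q (n + 1) : ℝ)⁻¹ := by
    rw [← hg.tsum_eq]
    exact ((summable_nat_add_iff n).2 h.summable_inv).tsum_le_tsum
      (fun j => h.inv_add_le (Nat.succ_pos n) j) hg.summable
  refine hle.trans ?_
  rw [div_eq_mul_inv]
  exact mul_le_mul_of_nonneg_right (by norm_num) (by positivity)

theorem exists_limit_HConj (h : IsChoice ψ α p q) (hψ : IsSmoothStep ψ) (a : ℕ → Bool) :
    ∃ F G : ℝ → ℝ, IsLiftPair F G ∧ TendstoUniformly (HConj ψ q a) F atTop ∧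
      Tendsto (fun n => ckDist 0 (HConj ψ q a n) F) atTop (𝓝 0) ∧
      ∀ n x, |Function.invFun (HConj ψ q a n) x - G x| ≤ 2 / q (n + 1) := by
  have hd := h.isDiffeoLift_HConj hψ a
  obtain ⟨F, -, hFb⟩ := exists_continuous_limit (fun n => (hd n).continuous)
    (h.summable_size_div hψ a) fun n x => by
      refine (h.abs_HConj_sub_le hψ a n _ _).trans ?_
      rw [div_eq_mul_inv]
      exact mul_le_mul_of_nonneg_left (h.abs_hConj_sub_le hψ a (Nat.succ_pos n) x)
        (zero_le_one.trans (h.one_le_size hψ a n))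
  obtain ⟨G, -, hGb⟩ := exists_continuous_limit (fun n => (hd n).invFun.continuous)
    h.summable_inv fun n x => by
      rw [h.invFun_HConj_succ hψ]
      exact h.abs_invFun_hConj_sub_le hψ a (Nat.succ_pos n) _
  have hF0 := tendsto_sum_nat_add fun n => size ψ q a n / q (n + 1)
  have hG0 := tendsto_sum_nat_add fun n => (q (n + 1) : ℝ)⁻¹
  have hFu := tendstoUniformly_of_abs_sub_le hF0 (.of_forall hFb)
  have hGu := tendstoUniformly_of_abs_sub_le hG0 (.of_forall hGb)
  have hpair := IsLiftPair.of_tendstoUniformly hd hFu hGu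
  refine ⟨F, G, hpair, hFu, ?_, fun n x => (hGb n x).trans (h.tsum_inv_le n)⟩
  refine squeeze_zero (fun n => ckDist_nonneg _ _ _) (fun n => ?_)
    (by simpa using hF0.max hG0)
  rw [ckDist, hpair.invFun_eq]
  refine max_le_max (ckNorm_le (tsum_nonneg fun j => ?_) fun i hi x => ?_)
    (ckNorm_le (tsum_nonneg fun j => ?_) fun i hi x => ?_)
  · have := h.one_le_size hψ a (j + n)
    positivity
  · obtain rfl : i = 0 := Nat.le_zero.1 hi
    simpa using hFb n x
  · positivity
  · obtain rfl : i = 0 := Nat.le_zero.1 hi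
    simpa using hGb n x

end IsChoice


/-! ### Neighbourhoods of finite subsets of the circle -/

theorem measurableSet_isNear (q : ℕ) (c r : ℝ) : MeasurableSet {x | IsNear q c r x} := by
  have : {x | IsNear q c r x} = ⋃ k : ℤ, {x : ℝ | |q * x - c - k| ≤ r} := by
    ext x
    rw [mem_iUnion]
    rfl
  rw [this]
  exact MeasurableSet.iUnion fun k => (isClosed_le (by fun_prop) continuous_const).measurableSet

theorem IsNear.of_abs_sub_le {q : ℕ} {c r r' x y : ℝ} (h : IsNear q c r x)
    (hr : q * |y - x| + r ≤ r') : IsNear q c r' y := by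
  obtain ⟨k, hk⟩ := h
  refine ⟨k, ?_⟩
  have e : (q : ℝ) * y - c - k = q * (y - x) + (q * x - c - k) := by ring
  rw [e]
  refine (abs_add_le _ _).trans ?_
  rw [abs_mul, Nat.abs_cast]
  linarith

theorem isNear_add_one {q : ℕ} {c r x : ℝ} : IsNear q c r (x + 1) ↔ IsNear q c r x := by
  constructor
  · rintro ⟨k, hk⟩
    refine ⟨k - q, ?_⟩
    convert hk using 2
    push_cast
    ring
  · rintro ⟨k, hk⟩
    refine ⟨k + q, ?_⟩
    convert hk using 2
    push_cast
    ring

theorem volume_image_isNear_le {K : ℝ → ℝ} (hK : Monotone K) {L : ℝ}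
    (hL : ∀ x y, |K x - K y| ≤ L * |x - y|) {q : ℕ} (hq : 1 ≤ q) {c r : ℝ}
    (hc : c ∈ Icc (0 : ℝ) 1) (hr0 : 0 ≤ r) (hr : r ≤ 1) :
    volume (K '' ({x | IsNear q c r x} ∩ Icc 0 1)) ≤ ENNReal.ofReal (L * (10 * r)) := by
  have hq' : (1 : ℝ) ≤ q := by exact_mod_cast hq
  have hq0 : (0 : ℝ) < q := by linarith
  have hL0 : 0 ≤ L := by simpa using (abs_nonneg _).trans (hL 1 0)
  have hsub : K '' ({x | IsNear q c r x} ∩ Icc 0 1) ⊆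
      -- Since `c` and `r` lie in `[0, 1]`, only these `q + 4 ≤ 5q` centres are relevant; each
      -- interval of length `2r/q` is stretched at most by `L`, for a total of `10 L r`.
      ⋃ k ∈ Finset.Icc (-2 : ℤ) (q + 1), Icc (K ((c + k - r) / q)) (K ((c + k + r) / q)) := by
    rintro _ ⟨x, ⟨⟨k, hk⟩, hx⟩, rfl⟩
    rw [abs_le] at hk
    have hx0 : 0 ≤ q * x := mul_nonneg hq0.le hx.1
    have hx1 : q * x ≤ q := mul_le_of_le_one_right hq0.le hx.2
    have hk1 : (-2 : ℤ) ≤ k := by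
      have : ((-2 : ℤ) : ℝ) ≤ k := by push_cast; linarith [hc.2]
      exact_mod_cast this
    have hk2 : k ≤ (q : ℤ) + 1 := by
      have : (k : ℝ) ≤ ((q + 1 : ℤ) : ℝ) := by push_cast; linarith [hc.1]
      exact_mod_cast this
    simp only [mem_iUnion, exists_prop]
    refine ⟨k, Finset.mem_Icc.2 ⟨hk1, hk2⟩, hK ?_, hK ?_⟩
    · rw [div_le_iff₀ hq0]; linarith
    · rw [le_div_iff₀ hq0]; linarith
  have hone : ∀ k : ℤ, volume (Icc (K ((c + k - r) / q)) (K ((c + k + r) / q))) ≤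
      ENNReal.ofReal (L * (2 * r / q)) := fun k => by
    rw [Real.volume_Icc]
    refine ENNReal.ofReal_le_ofReal ((le_abs_self _).trans ((hL _ _).trans_eq ?_))
    have e : (c + k + r) / q - (c + k - r) / q = 2 * r / q := by ring
    rw [e, abs_of_nonneg (by positivity)]
  calc volume (K '' ({x | IsNear q c r x} ∩ Icc 0 1))
      ≤ ∑ k ∈ Finset.Icc (-2 : ℤ) (q + 1),
          volume (Icc (K ((c + k - r) / q)) (K ((c + k + r) / q))) :=
        (measure_mono hsub).trans (measure_biUnion_finset_le _ _)
    _ ≤ ∑ _k ∈ Finset.Icc (-2 : ℤ) (q + 1), ENNReal.ofReal (L * (2 * r / q)) :=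
        Finset.sum_le_sum fun k _ => hone k
    _ = ENNReal.ofReal ((q + 4 : ℕ) * (L * (2 * r / q))) := by
        have hcard : (Finset.Icc (-2 : ℤ) (q + 1)).card = q + 4 := by
          rw [Int.card_Icc]; omega
        rw [Finset.sum_const, hcard, nsmul_eq_mul, ENNReal.ofReal_mul (Nat.cast_nonneg _),
          ENNReal.ofReal_natCast]
    _ ≤ ENNReal.ofReal (L * (10 * r)) := by
        apply ENNReal.ofReal_le_ofReal
        have e : ((q + 4 : ℕ) : ℝ) * (L * (2 * r / q)) = (q + 4) / q * (L * (2 * r)) := by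
          push_cast; ring
        have h5 : ((q : ℝ) + 4) / q ≤ 5 := by rw [div_le_iff₀ hq0]; linarith
        rw [e]
        refine (mul_le_mul_of_nonneg_right h5 (by positivity)).trans_eq ?_
        ring

/-! ### Subsets of the circle and periodic subsets of the line -/

/-- The subset of the circle whose preimage is a given `1`-periodic subset of the line. -/
def circleSet (s : Set ℝ) : Set UnitAddCircle :=
  {z | (AddCircle.measurableEquivIoc (1 : ℝ) 0 z : ℝ) ∈ s}

theorem measurableSet_circleSet {s : Set ℝ} (hs : MeasurableSet s) :
    MeasurableSet (circleSet s) :=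
  (AddCircle.measurableEquivIoc (1 : ℝ) 0).measurable (measurable_subtype_coe hs)

theorem coe_mem_circleSet {s : Set ℝ} (hs : ∀ x, x + 1 ∈ s ↔ x ∈ s) (x : ℝ) :
    (x : UnitAddCircle) ∈ circleSet s ↔ x ∈ s := by
  have hper : Function.Periodic (fun x => x ∈ s) 1 := fun x => propext (hs x)
  have h1 : ((AddCircle.measurableEquivIoc (1 : ℝ) 0 (x : UnitAddCircle) : ℝ) : UnitAddCircle) =
      x := AddCircle.coe_equivIoc
  have h2 := congrArg hper.lift h1
  exact iff_of_eq h2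

theorem volume_eq_zero_of_ae {s : Set UnitAddCircle} (hs : MeasurableSet s)
    (h : ∀ᵐ x : ℝ ∂(volume.restrict (Ioc (0 : ℝ) 1)), (x : UnitAddCircle) ∉ s) : volume s = 0 := by
  have hmp : MeasurePreserving ((↑) : ℝ → UnitAddCircle) _ volume :=
    UnitAddCircle.measurePreserving_mk 0
  rw [zero_add] at hmp
  rw [← hmp.measure_preimage hs.nullMeasurableSet]
  exact measure_eq_zero_iff_ae_notMem.2 h

/-! ### Singularity -/

namespace IsChoice

variable {ψ : ℝ → ℝ} {α : ℝ} {p : ℕ → ℤ} {q : ℕ → ℕ}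

/-- A periodic null set of the line which the limit of the `H_{a,n}` maps to a conull set. -/
theorem exists_singular_set (h : IsChoice ψ α p q) (hψ : IsSmoothStep ψ) (a : ℕ → Bool)
    {F G : ℝ → ℝ} (hFG : IsLiftPair F G)
    (hG : ∀ n x, |Function.invFun (HConj ψ q a n) x - G x| ≤ 2 / q (n + 1)) :
    ∃ s : Set ℝ, MeasurableSet s ∧ (∀ x, x + 1 ∈ s ↔ x ∈ s) ∧
      (∀ᵐ x ∂(volume.restrict (Ioc (0 : ℝ) 1)), x ∉ s) ∧
      ∀ᵐ y ∂(volume.restrict (Ioc (0 : ℝ) 1)), G y ∈ s := by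
  have hd := h.isDiffeoLift_HConj hψ a
  choose c hc c' hc' hcc using fun n => h.exists_isNear_hConj hψ a (Nat.succ_pos n)
  have hq1 : ∀ n, 1 ≤ q (n + 1) := fun n => le_trans (by norm_num) (h.ten_le (Nat.succ_pos n))
  set t : ℕ → ℝ := fun n => tSeq q (n + 1)
  have ht : ∀ n, 0 < t n := fun n => h.tSeq_pos (Nat.succ_pos n)
  have ht' : ∀ n, t n ≤ 1 / 10 := fun n => h.tSeq_le (Nat.succ_pos n)
  set E : ℕ → Set ℝ := fun n => {x | IsNear (q (n + 1)) (c n) (5 * t n) x}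
  -- The map `H_{n+1}⁻¹ ∘ F` is nearly the identity, so `D n` is a small perturbation of `E n`,
  -- chosen so that its image under `F` is exactly `H_{n+1}(E n)`.
  set D : ℕ → Set ℝ := fun n => {x | Function.invFun (HConj ψ q a (n + 1)) (F x) ∈ E n}
  refine ⟨limsup D atTop, MeasurableSet.measurableSet_limsup fun n => ?_, fun x => ?_, ?_, ?_⟩
  · exact ((hd _).invFun.continuous.comp hFG.continuous).measurable (measurableSet_isNear _ _ _)
  · have : ∀ n, x + 1 ∈ D n ↔ x ∈ D n := fun n => by
      simp only [D, E, mem_ofPred_eq]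
      rw [hFG.map_add_one, (hd _).invFun.map_add_one, isNear_add_one]
    rw [mem_limsup_iff_frequently_mem, mem_limsup_iff_frequently_mem]
    simp only [this]
  -- The perturbation, rescaled by `q_{n+1}`, is at most `2 q_{n+1}/q_{n+2} ≤ 2t`, so radius `5t`
  -- grows to at most `7t`; `9t` is a convenient upper bound and is still below 1.
  · have hb : ∀ n, volume.restrict (Ioc (0 : ℝ) 1) (D n) ≤ ENNReal.ofReal (1 * (10 * (9 * t n))) :=
      fun n => by
        by_cases htn : 9 * t n ≤ 1
        · refine le_trans ?_ (volume_image_isNear_le (K := id) monotone_id (L := 1)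
            (fun x y => by simp) (hq1 n) (hc n) (by linarith [ht n]) htn)
          rw [Measure.restrict_apply' measurableSet_Ioc]
          refine measure_mono fun x ⟨hx, hx'⟩ => ⟨x, ⟨?_, hx'.1.le, hx'.2⟩, rfl⟩
          refine IsNear.of_abs_sub_le hx ?_
          have h1 := hG (n + 1) (F x)
          rw [hFG.inv_apply, abs_sub_comm] at h1
          have h2 := mul_le_mul_of_nonneg_left h1 (Nat.cast_nonneg (α := ℝ) (q (n + 1)))
          have h3 := h.div_le_tSeq (Nat.succ_pos n)
          have e : (q (n + 1) : ℝ) * (2 / q (n + 1 + 1)) = 2 * (q (n + 1) / q (n + 1 + 1)) := by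
            ring
          rw [e] at h2
          linarith [ht n]
        · exact absurd (by linarith [ht' n]) htn
    have hsum : ∑' n, volume.restrict (Ioc (0 : ℝ) 1) (D n) ≠ ⊤ :=
      ((ENNReal.tsum_le_tsum hb).trans_lt (Summable.tsum_ofReal_lt_top
        (((h.summable_tSeq.mul_left 9).mul_left 10).mul_left 1))).ne
    filter_upwards [ae_eventually_notMem hsum] with x hx
    rw [mem_limsup_iff_frequently_mem, not_frequently]
    exact hx
  -- A point `y` of `D' n` has `H_{n+1}⁻¹ y` outside the first neighbourhood, so `h_{n+1}` sends it
  -- into the second one. Thus `y` lies in the image of the latter under the Lipschitz map `H_n`.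
  · set D' : ℕ → Set ℝ := fun n => {y | Function.invFun (HConj ψ q a (n + 1)) y ∉ E n}
    have hb : ∀ n, volume.restrict (Ioc (0 : ℝ) 1) (D' n) ≤
        ENNReal.ofReal (50 * (size ψ q a n / q (n + 1))) := fun n => by
      have hS := h.one_le_size hψ a n
      refine le_trans ?_ ((volume_image_isNear_le (hd n).strictMono.monotone
        (h.abs_HConj_sub_le hψ a n) (hq1 n) (hc' n) (r := 5 * t n) (by linarith [ht n])
        (by linarith [ht' n])).trans (ENNReal.ofReal_le_ofReal ?_))
      · rw [Measure.restrict_apply' measurableSet_Ioc]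
        refine measure_mono fun y ⟨hy, hy'⟩ =>
          ⟨Function.invFun (HConj ψ q a n) y, ⟨?_, ?_, ?_⟩, (hd n).apply_invFun y⟩
        · have := (hcc n (Function.invFun (HConj ψ q a (n + 1)) y)).resolve_left hy
          rwa [h.invFun_HConj_succ hψ,
            (h.isDiffeoLift_hConj hψ a (Nat.succ_pos n)).apply_invFun] at this
        · rw [← (hd n).invFun_zero (h.HConj_zero hψ a n)]
          exact (hd n).invFun.strictMono.monotone hy'.1.le
        · have h1 := (hd n).invFun.map_add_one 0
          rw [(hd n).invFun_zero (h.HConj_zero hψ a n), zero_add] at h1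
          rw [← h1]
          exact (hd n).invFun.strictMono.monotone hy'.2
      · have h1 : t n ≤ (q (n + 1) : ℝ)⁻¹ := h.tSeq_le_inv (Nat.succ_pos n)
        have h2 := mul_le_mul_of_nonneg_left h1 (zero_le_one.trans hS)
        rw [div_eq_mul_inv]
        linarith
    have hsum : ∑' n, volume.restrict (Ioc (0 : ℝ) 1) (D' n) ≠ ⊤ :=
      ((ENNReal.tsum_le_tsum hb).trans_lt (Summable.tsum_ofReal_lt_top
        ((h.summable_size_div hψ a).mul_left 50))).ne
    filter_upwards [ae_eventually_notMem hsum] with y hy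
    rw [mem_limsup_iff_frequently_mem]
    refine Eventually.frequently (hy.mono fun n hn => ?_)
    simp only [D, D', mem_ofPred_eq, not_not] at hn ⊢
    rwa [hFG.apply_inv]

theorem isSingular (h : IsChoice ψ α p q) (hψ : IsSmoothStep ψ) (a : ℕ → Bool)
    {F G : ℝ → ℝ} (hFG : IsLiftPair F G)
    (hG : ∀ n x, |Function.invFun (HConj ψ q a n) x - G x| ≤ 2 / q (n + 1)) :
    IsSingular hFG.homeomorph := by
  obtain ⟨s, hs, hper, h0, h1⟩ := h.exists_singular_set hψ a hFG hG
  have hm := measurableSet_circleSet hs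
  refine ⟨circleSet s, hm, volume_eq_zero_of_ae hm ?_, volume_eq_zero_of_ae ?_ ?_⟩
  · simpa only [coe_mem_circleSet hper] using h0
  · exact (hFG.homeomorph.measurableEmbedding.measurableSet_image.2 hm).compl
  · filter_upwards [h1] with y hy
    rw [notMem_compl_iff]
    exact ⟨(G y : UnitAddCircle), (coe_mem_circleSet hper _).2 hy, by
      rw [hFG.homeomorph_coe, hFG.apply_inv]⟩

end IsChoice

theorem IsSingular.exists_image_null {f : UnitAddCircle ≃ₜ UnitAddCircle} (hf : IsSingular f) :
    ∃ C : Set UnitAddCircle, MeasurableSet C ∧ 0 < volume C ∧ volume (f '' C) = 0 := by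
  obtain ⟨N, hN, hN0, hN1⟩ := hf
  refine ⟨Nᶜ, hN.compl, ?_, ?_⟩
  · rw [measure_compl hN (by simp [hN0]), hN0, UnitAddCircle.measure_univ]
    simp
  · rwa [image_compl_eq f.bijective]

end AbC
end

theorem mainTheorem7 (ψ : ℝ → ℝ) (hψ : AbC.IsSmoothStep ψ) (α : ℝ) (hα : Liouville α)
    (p : ℕ → ℤ) (q : ℕ → ℕ) (hpq : AbC.IsChoice ψ α p q) (a : ℕ → Bool) :
    ∃ (T H : UnitAddCircle ≃ₜ UnitAddCircle) (liftT liftH : ℝ → ℝ),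
      -- `T = T_a` is the limit of `T_{a,n}` in the space of smooth circle diffeomorphisms
      AbC.IsLift liftT T ∧ ContDiff ℝ ∞ liftT ∧ ContDiff ℝ ∞ (Function.invFun liftT) ∧
      (∀ k : ℕ, Tendsto (fun n => AbC.ckDist k (AbC.TApprox ψ p q a n) liftT) atTop (𝓝 0)) ∧
      -- `H = H_a` is the limit of `H_{a,n}` in the space of circle homeomorphisms
      AbC.IsLift liftH H ∧
      Tendsto (fun n => AbC.ckDist 0 (AbC.HConj ψ q a n) liftH) atTop (𝓝 0) ∧
      -- `H` conjugates the rotation by `α` to `T`, and fixes `0`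
      H 0 = 0 ∧ (∀ x : UnitAddCircle, H (x + (α : UnitAddCircle)) = T (H x)) ∧
      -- `H` is singular
      AbC.IsSingular H ∧
      ∃ C : Set UnitAddCircle, MeasurableSet C ∧ 0 < volume C ∧ volume (H '' C) = 0 := by
  obtain ⟨FT, GT, hT, hTs, hTs', hTu, hTk⟩ := hpq.exists_limit_TApprox hψ a
  obtain ⟨FH, GH, hH, hHu, hHk, hHG⟩ := hpq.exists_limit_HConj hψ a
  have hsing := hpq.isSingular hψ a hH hHG
  refine ⟨hT.homeomorph, hH.homeomorph, FT, FH, hT.isLift, hTs, ?_, hTk, hH.isLift, hHk, ?_, ?_,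
    hsing, hsing.exists_image_null⟩
  · rwa [hT.invFun_eq]
  · have h0 : FH 0 = 0 := by
      have := hHu.tendsto_at 0
      simp only [hpq.HConj_zero hψ a] at this
      exact tendsto_nhds_unique this tendsto_const_nhds
    have := hH.homeomorph_coe 0
    rwa [h0] at this
  · intro z
    induction z using QuotientAddGroup.induction_on with
    | H x =>
      have h1 : Tendsto (fun n => x + AbC.alphaSeq p q (n + 1)) atTop (𝓝 (x + α)) :=
        ((hpq.tendsto_alphaSeq hψ).comp (tendsto_add_atTop_nat 1)).const_add x
      have h2 := hHu.tendsto_comp hH.continuous.continuousAt h1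
      have h3 := hTu.tendsto_comp hT.continuous.continuousAt (hHu.tendsto_at x)
      -- Pass to the limit in `H_n(x + α_{n+1}) = T_n(H_n x)`; uniform convergence allows the
      -- arguments to vary with `n`.
      have h4 : FH (x + α) = FT (FH x) := by
        refine tendsto_nhds_unique h2 (h3.congr fun n => ?_)
        rw [AbC.TApprox, (hpq.isDiffeoLift_HConj hψ a n).invFun_apply]
      change hH.homeomorph ((x + α : ℝ) : UnitAddCircle) = _
      rw [hH.homeomorph_coe, h4]
      rfl
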